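/- For $\omega\in\mathbb S^2\subset\mathbb R^3$ and $t\in\mathbb R$ let $\omega^\perp(t)=\omega^\perp+t\omega$, and for a Schwartz function $v:\mathbb R^3\to\mathbb C$ let $\delta_{\omega^\perp(t)}v$ be the complex measure with density $v$ with respect to the two-dimensional surface measure on the plane $\omega^\perp(t)$. For a Schwartz function $V$, or a complex measure of this form, put $\widehat V(\xi)=\int e^{-ix\cdot\xi}\,V(dx)$, $$L_V(r,\theta)=\int_0^\infty \widehat V(-\tau\theta)\,e^{\frac i2 r\tau}\,\tau\,d\tau\quad (r\in\mathbb R,\ \theta\in\mathbb S^2),\qquad |\!|\!|V|\!|\!|=\int_{\mathbb R\times\mathbb S^2}|L_V(r,\theta)|\,dr\,d\theta ,$$ and define $$\|v\|_B=\sup_{\omega\in\mathbb S^2}\int_{-\infty}^\infty |\!|\!|\delta_{\omega^\perp(t)}v|\!|\!|\,dt ,$$ which is the supremum over all planes through the origin. (For $V=\delta_{\omega^\perp(t)}v$ the integral defining $L_V(r,\theta)$ converges absolutely for every $\theta\neq\pm\omega$.) For $\lambda>0$ set $v_\lambda(x)=\lambda^{-2}v(x/\lambda)$. (1) For every Schwartz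 function $v$ and every $\lambda>0$, $\|v_\lambda\|_B=\|v\|_B$. (2) For every Schwartz function $v$, $\|v\|_B<\infty$. (3) Let $\psi\in C_c^\infty(\mathbb R^3\setminus\{0\};\mathbb R)$ generate a Littlewood–Paley partition of unity, i.e. $\sum_{k\in\mathbb Z}\psi(2^{-k}x)=1$ for all $x\ne0$, and set $$\|v\|_B^*=\sup_{\omega\in\mathbb S^2}\int_{-\infty}^\infty\sum_{k\in\mathbb Z}2^{k/2}\,\big\|\psi(2^{-k}x')\,v(x'+s\omega)\big\|_{\dot H^{1/2}_{x'}(\omega^\perp)}\,ds ,$$ where $\|f\|_{\dot H^{1/2}(\omega^\perp)}=\|\,|\nabla|^{1/2}f\|_{L^2(\omega^\perp)}$ on the plane $\omega^\perp\cong\mathbb R^2$. Then there is a constant $C<\infty$, depending only on $\psi$, such that $\|v\|_B\le C\|v\|_B^*$ for all Schwartz functions $v$; moreover $\|v\|_B^*<\infty$ for every Schwartz function $v$, and $\|v_\lambda\|_B^*=\|v\|_B^*$ for every Schwartz function $v$ and every $\lambda=2^{-\ell}$, $\ell\in\mathbb Z$. -/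

import Mathlib

open MeasureTheory
open scoped FourierTransform ENNReal NNReal RealInnerProductSpace SchwartzMap

noncomputable section

namespace StructureNorm

/-- Three-dimensional Euclidean space. -/
abbrev E3 : Type := EuclideanSpace ℝ (Fin 3)

/-- The unit sphere of `ℝ³`. -/
abbrev S2 : Type := Metric.sphere (0 : E3) 1

/-- The plane `ω^⊥` through the origin with unit normal `ω`. Every two-dimensional plane through
the origin is of this form. -/
abbrev perp (ω : S2) : Submodule ℝ E3 := (ℝ ∙ (ω : E3))ᗮ

/-- Lebesgue measure of a finite-dimensional Euclidean space: parallelepipeds spanned by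
orthonormal bases have measure `1`. -/
def lebesgue (F : Type*) [NormedAddCommGroup F] [InnerProductSpace ℝ F] [FiniteDimensional ℝ F]
    [MeasurableSpace F] [BorelSpace F] : Measure F := volume

/-- Surface measure `δ_{Π(t)}` of the affine plane `Π(t) = N^⊥ + t N`: two-dimensional Lebesgue
measure on `N^⊥`, translated by `t N`. -/
def planeMeasure (N : S2) (t : ℝ) : Measure E3 :=
  (lebesgue (perp N)).map (fun x' : perp N => (x' : E3) + t • (N : E3))

/-- The Fourier transform `ξ ↦ ∫ e^{-i x·ξ} v(x) dμ(x)` of the complex measure `v μ`. For `μ`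
Lebesgue measure this is the Fourier transform of the function `v`, for
`μ = planeMeasure N t` that of `δ_{Π(t)} v`. -/
def fourierMeas (μ : Measure E3) (v : E3 → ℂ) (ξ : E3) : ℂ :=
  ∫ x, Complex.exp (-Complex.I * (⟪x, ξ⟫ : ℝ)) * v x ∂μ

/-- `L_V(r, ω) = ∫₀^∞ V̂(-τ ω) e^{i r τ / 2} τ dτ` for the complex measure `V = v μ`. -/
def LTransform (μ : Measure E3) (v : E3 → ℂ) (r : ℝ) (ω : S2) : ℂ :=
  ∫ τ in Set.Ioi (0 : ℝ),
    fourierMeas μ v (-(τ • (ω : E3))) * Complex.exp (Complex.I / 2 * r * τ) * τ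

/-- `|||V||| = ‖L_V‖_{L¹(ℝ × S²)}` for the complex measure `V = v μ`; the sphere carries its
surface measure (total mass `4 π`). -/
def tripleNorm (μ : Measure E3) (v : E3 → ℂ) : ℝ≥0∞ :=
  ∫⁻ p : ℝ × S2, ‖LTransform μ v p.1 p.2‖ₑ
    ∂((volume : Measure ℝ).prod (volume : Measure E3).toSphere)

/-- `‖v‖_B = sup_Π ∫ |||δ_{Π(t)} v||| dt`, the supremum over the planes `Π = N^⊥`. -/
def normB (v : E3 → ℂ) : ℝ≥0∞ :=
  ⨆ N : S2, ∫⁻ t : ℝ, tripleNorm (planeMeasure N t) v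

/-- The homogeneous Sobolev norm `‖f‖_{Ḣ^{1/2}(F)} = ‖ |∇|^{1/2} f ‖_{L²(F)}` of an integrable
function on a Euclidean space. Here `𝓕 f ξ = ∫ e^{-2πi x·ξ} f(x) dx`, so `|∇|^{1/2}` has
the symbol `(2π|ξ|)^{1/2}`. -/
def homSobolevHalf {F : Type*} [NormedAddCommGroup F] [InnerProductSpace ℝ F]
    [FiniteDimensional ℝ F] [MeasurableSpace F] [BorelSpace F] (f : F → ℂ) : ℝ≥0∞ :=
  (∫⁻ ξ, ENNReal.ofReal (2 * Real.pi * ‖ξ‖) * ‖𝓕 f ξ‖ₑ ^ 2 ∂(lebesgue F)) ^ (1 / 2 : ℝ)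

/-- `ψ ∈ C_c^∞(ℝ³ ∖ {0})` generates a dyadic (Littlewood-Paley) partition of unity:
`∑_{k ∈ ℤ} ψ(2^{-k} x) = 1` for all `x ≠ 0`. -/
structure IsLittlewoodPaley (ψ : E3 → ℝ) : Prop where
  smooth : ContDiff ℝ (⊤ : ℕ∞) ψ
  hasCompactSupport : HasCompactSupport ψ
  zero_notMem : (0 : E3) ∉ tsupport ψ
  hasSum : ∀ x : E3, x ≠ 0 → HasSum (fun k : ℤ => ψ ((2 : ℝ) ^ (-k) • x)) 1

/-- The piece `x' ↦ ψ(2^{-k} x') v(x' + s ω)` on the plane `ω^⊥`. -/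
def piece (ψ : E3 → ℝ) (v : E3 → ℂ) (ω : S2) (s : ℝ) (k : ℤ) (x' : perp ω) : ℂ :=
  (ψ ((2 : ℝ) ^ (-k) • (x' : E3)) : ℂ) * v ((x' : E3) + s • (ω : E3))

/-- `‖v‖_B^* = sup_ω ∫ ∑_k 2^{k/2} ‖ψ(2^{-k} x') v(x' + s ω)‖_{Ḣ^{1/2}(ω^⊥)} ds`. -/
def normBStar (ψ : E3 → ℝ) (v : E3 → ℂ) : ℝ≥0∞ :=
  ⨆ ω : S2, ∫⁻ s : ℝ, ∑' k : ℤ,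
    ENNReal.ofReal ((2 : ℝ) ^ ((k : ℝ) / 2)) * homSobolevHalf (piece ψ v ω s k)

/-- The rescaled function `v_l(x) = l^{-2} v(x / l)`. -/
def rescale (l : ℝ) (v : E3 → ℂ) (x : E3) : ℂ := ((l ^ (-2 : ℤ) : ℝ) : ℂ) * v (l⁻¹ • x)

end StructureNorm

end

/-!
For a plane `N^⊥` write `ω'` for the projection of `ω` to it. For a function `f` on `N^⊥` put
`L_ε f(y, a) = ∫ f(x) (ε - i (⟪x, y⟫ + a))⁻² dx` (`regL`). Since `∫₀^∞ τ e^{-ετ} e^{isτ} dτ =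
(ε - i s)⁻²`, this is the integral defining the transform of the measure `f dx` with the convergence
factor `e^{-ετ}` inserted, and it tends to `L_V(r, ω)` as `ε → 0` when `f` is the restriction of `v`
to the plane `N^⊥ + t N`, `y = ω'`, `a = t ⟪N, ω⟫ + r / 2`, and `ω' ≠ 0` (`tendsto_regL`). The shift
`t ⟪N, ω⟫` does not affect the integral over `r`.

*The norms compare.* Let `f` be supported in a disc of radius `R`. For `|r| ≤ 4 R |ω'|` the
Cauchy-Schwarz inequality and Plancherel's theorem in `r` bound the integral of `|L_ε f|` by
`(R |ω'|)^{1/2} (∫ τ² |f^(τ ω')|² dτ)^{1/2}`. A second application of Cauchy-Schwarz, now over the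
sphere with the integrable weight `|ω'|⁻¹` (`exists_lintegral_inv_proj_le`), leads to the integral of
`|ω'|² τ² |f^(τ ω')|²`, which is a multiple of the square of the `Ḣ^{1/2}` norm of `f`
(`lintegral_sphere_proj`). For `|r| > 4 R |ω'|` the kernel is `O(r⁻²)`, which contributes
`(R |ω'|)⁻¹ ‖f‖_{L¹}`, and `‖f‖_{L¹} ≲ R ‖f‖_{L²} ≲ R^{3/2} ‖f‖_{Ḣ^{1/2}}` by a Poincaré inequality
for functions supported in a disc (`lintegral_enorm_sq_le`). Altogether
`∫∫ |L_ε f| dr dω ≲ R^{1/2} ‖f‖_{Ḣ^{1/2}}`, uniformly in `ε` (`exists_lintegral_regL_le`). Summing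
over the Littlewood-Paley pieces, whose supports have `R ≲ 2^k`, and letting `ε → 0` with Fatou's
lemma gives `normB v ≤ C * normBStar ψ v` (`exists_normB_le`).

*The norms are finite.* The elementary interpolation `‖f‖²_{Ḣ^{1/2}} ≲ l ‖f‖² + l⁻¹ ‖∇f‖²` with
`l = 2^{-k}`, together with the rapid decay of `v` and `∇v`, bounds the `k`-th term of `normBStar` by
a multiple of `2^{-|k|} (1 + s²)⁻¹` (`IsLittlewoodPaley.exists_homSobolevHalf_piece_le`). Finiteness
of `normB` follows by comparison, once some Littlewood-Paley function is known to exist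
(`exists_isLittlewoodPaley`).

*Scaling* is a change of variables; for dyadic factors it also shifts the index of the
Littlewood-Paley pieces (`piece_rescale`).
-/

namespace StructureNorm

/-! ### Plancherel's theorem, changes of variables and polar coordinates -/

/-- The Fourier integral of a function in `L¹ ∩ L²` agrees almost everywhere with its Fourier
transform as an element of `L²`: both define the same tempered distribution. -/
theorem fourier_coeFn_toLp {E : Type*} [NormedAddCommGroup E] [InnerProductSpace ℝ E]
    [FiniteDimensional ℝ E] [MeasurableSpace E] [BorelSpace E] {f : E → ℂ}
    (hf : Integrable f) (hf2 : MemLp f 2) :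
    𝓕 f =ᵐ[volume] (𝓕 (hf2.toLp f) : Lp (α := E) ℂ 2) := by
  apply ae_eq_of_integral_contDiff_smul_eq
  · have : Continuous (𝓕 f) := VectorFourier.fourierIntegral_continuous
      Real.continuous_fourierChar continuous_inner hf
    exact this.locallyIntegrable
  · exact (Lp.memLp _).locallyIntegrable (by norm_num)
  · intro g hg hgc
    have hg₁ : HasCompactSupport (Complex.ofRealCLM ∘ g) := hgc.comp_left rfl
    have hg₂ : ContDiff ℝ (⊤ : ℕ∞) (Complex.ofRealCLM ∘ g) := by fun_prop
    set G := hg₁.toSchwartzMap hg₂ with hG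
    have h1 := congrArg (fun T => T G) (Lp.fourier_toTemperedDistribution_eq (hf2.toLp f))
    simp only [TemperedDistribution.fourier_apply, Lp.toTemperedDistribution_apply] at h1
    have h2 : ∫ x, (𝓕 G) x • (hf2.toLp f) x = ∫ x, (𝓕 G) x • f x := by
      apply integral_congr_ae
      filter_upwards [hf2.coeFn_toLp] with x hx
      rw [hx]
    have h3 : ∫ ξ, (𝓕 G) ξ • f ξ = ∫ x, G x • 𝓕 f x := by
      simpa using! (VectorFourier.integral_fourierIntegral_smul_eq_flip (L := innerₗ E)
        Real.continuous_fourierChar continuous_inner G.integrable hf)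
    rw [h2, h3] at h1
    simpa [hG] using h1

/-- Plancherel's theorem on `L¹ ∩ L²`, for the Fourier integral. -/
theorem lintegral_enorm_sq_fourier {E : Type*} [NormedAddCommGroup E] [InnerProductSpace ℝ E]
    [FiniteDimensional ℝ E] [MeasurableSpace E] [BorelSpace E] {f : E → ℂ}
    (hf : Integrable f) (hf2 : MemLp f 2) :
    ∫⁻ ξ, ‖𝓕 f ξ‖ₑ ^ 2 = ∫⁻ x, ‖f x‖ₑ ^ 2 := by
  have h : eLpNorm (𝓕 f) 2 volume = eLpNorm f 2 volume := by
    rw [eLpNorm_congr_ae (fourier_coeFn_toLp hf hf2), ← eLpNorm_congr_ae hf2.coeFn_toLp]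
    have := Lp.norm_fourier_eq (hf2.toLp f)
    rw [Lp.norm_def, Lp.norm_def] at this
    exact (ENNReal.toReal_eq_toReal_iff' (Lp.eLpNorm_ne_top _) (Lp.eLpNorm_ne_top _)).1 this
  rw [eLpNorm_eq_lintegral_rpow_enorm_toReal (by norm_num) (by norm_num),
    eLpNorm_eq_lintegral_rpow_enorm_toReal (by norm_num) (by norm_num)] at h
  have := congrArg (fun t : ℝ≥0∞ => t ^ (2:ℝ)) h
  simp only [← ENNReal.rpow_mul] at this
  simpa using this

theorem lintegral_comp_smul {E : Type*} [NormedAddCommGroup E] [NormedSpace ℝ E]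
    [FiniteDimensional ℝ E] [MeasurableSpace E] [BorelSpace E] (μ : Measure E)
    [μ.IsAddHaarMeasure] (f : E → ℝ≥0∞) {c : ℝ} (hc : c ≠ 0) :
    ∫⁻ x, f (c • x) ∂μ = ENNReal.ofReal |(c ^ Module.finrank ℝ E)⁻¹| * ∫⁻ x, f x ∂μ := by
  have h := lintegral_map_equiv (μ := μ) f (Homeomorph.smulOfNeZero c hc).toMeasurableEquiv
  have h2 : Measure.map (Homeomorph.smulOfNeZero c hc).toMeasurableEquiv μ =
      ENNReal.ofReal |(c ^ Module.finrank ℝ E)⁻¹| • μ := by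
    simpa using Measure.map_addHaar_smul μ hc
  rw [h2, lintegral_smul_measure] at h
  exact h.symm

theorem lintegral_comp_mul_left (f : ℝ → ℝ≥0∞) {c : ℝ} (hc : c ≠ 0) :
    ∫⁻ x, f (c * x) = ENNReal.ofReal |c⁻¹| * ∫⁻ x, f x := by
  simpa using lintegral_comp_smul volume f hc

/-- Plancherel's theorem in the normalisation `∫ g(τ) e^{irτ/2} dτ`, which is `𝓕 g` at
`-r / (4 π)`. -/
theorem lintegral_enorm_sq_integral_exp {g : ℝ → ℂ} (hg : Integrable g) (hg2 : MemLp g 2) :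
    ∫⁻ r : ℝ, ‖∫ τ, g τ * Complex.exp (Complex.I / 2 * r * τ)‖ₑ ^ 2 =
      ENNReal.ofReal (4 * Real.pi) * ∫⁻ τ, ‖g τ‖ₑ ^ 2 := by
  have h : ∀ r : ℝ, ∫ τ, g τ * Complex.exp (Complex.I / 2 * r * τ) =
      𝓕 g ((-(4 * Real.pi))⁻¹ * r) := by
    intro r
    rw [Real.fourier_real_eq_integral_exp_smul]
    congr 1; ext τ
    rw [smul_eq_mul, mul_comm]
    congr 2
    have := Real.pi_ne_zero
    push_cast
    field_simp
    ring
  simp_rw [h]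
  have hp : (-(4 * Real.pi))⁻¹ ≠ 0 := by simp [Real.pi_ne_zero]
  rw [lintegral_comp_mul_left (fun r => ‖𝓕 g r‖ₑ ^ 2) hp, lintegral_enorm_sq_fourier hg hg2]
  simp [abs_of_pos Real.pi_pos]

theorem lintegral_orthogonal_sum {E U V : Type*} [NormedAddCommGroup E] [InnerProductSpace ℝ E]
    [FiniteDimensional ℝ E] [MeasurableSpace E] [BorelSpace E]
    [NormedAddCommGroup U] [InnerProductSpace ℝ U]
    [FiniteDimensional ℝ U] [MeasurableSpace U] [BorelSpace U]
    [NormedAddCommGroup V] [InnerProductSpace ℝ V]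
    [FiniteDimensional ℝ V] [MeasurableSpace V] [BorelSpace V]
    (e : WithLp 2 (U × V) ≃ₗᵢ[ℝ] E) {G : E → ℝ≥0∞} (hG : Measurable G) :
    ∫⁻ x, G x = ∫⁻ v : V, ∫⁻ u : U, G (e (WithLp.toLp 2 (u, v))) := by
  rw [← e.measurePreserving.lintegral_comp hG,
    ← (WithLp.volume_preserving_toLp U V).lintegral_comp (by fun_prop), Measure.volume_eq_prod,
    lintegral_prod_symm _ (by fun_prop)]

/-- Fubini's theorem along the decomposition `ℝ³ = N^⊥ ⊕ ℝ N`. -/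
theorem lintegral_perp_prod (N : S2) {G : E3 → ℝ≥0∞} (hG : Measurable G) :
    ∫⁻ x, G x = ∫⁻ x' : perp N, (∫⁻ z : ℝ, G (x' + z • (N : E3))) ∂(lebesgue (perp N)) := by
  rw [lintegral_orthogonal_sum (Submodule.orthogonalDecomposition (ℝ ∙ (N : E3))).symm hG]
  have hN : ‖(N : E3)‖ = 1 := by simp
  refine lintegral_congr fun v => ?_
  rw [← (LinearIsometryEquiv.toSpanUnitSingleton (N : E3) hN).measurePreserving.lintegral_comp
    (by fun_prop)]
  refine lintegral_congr fun u => ?_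
  rw [LinearIsometryEquiv.toSpanUnitSingleton_apply]
  rw [add_comm]
  rfl

theorem lintegral_polar {G : E3 → ℝ≥0∞} (hG : Measurable G) :
    ∫⁻ x, G x = ∫⁻ ω : S2, (∫⁻ τ in Set.Ioi (0:ℝ), ENNReal.ofReal (τ ^ 2) * G (τ • (ω : E3)))
      ∂(volume : Measure E3).toSphere := by
  have h := (volume : Measure E3).measurePreserving_homeomorphUnitSphereProd.symm
    (homeomorphUnitSphereProd E3).toMeasurableEquiv
  have hd : Module.finrank ℝ E3 - 1 = 2 := by simp
  rw [hd] at h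
  have h0 : ∫⁻ x, G x = ∫⁻ x in {0}ᶜ, G x := by rw [restrict_compl_singleton]
  rw [h0, ← lintegral_subtype_comap (measurableSet_singleton _).compl,
    ← h.lintegral_comp (f := fun x => G x) (by fun_prop), lintegral_prod]
  · refine lintegral_congr fun ω => ?_
    rw [Measure.volumeIoiPow, lintegral_withDensity_eq_lintegral_mul _ (by fun_prop)]
    · rw [← lintegral_subtype_comap measurableSet_Ioi]
      rfl
    · have : Measurable fun τ : Set.Ioi (0:ℝ) =>
        (((homeomorphUnitSphereProd E3).toMeasurableEquiv.symm (ω, τ) : _) : E3) := by fun_prop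
      exact hG.comp this
  · refine (Measurable.aemeasurable ?_)
    exact hG.comp (by fun_prop)

/-! ### Projections of the sphere to a plane -/

/-- The orthogonal projection of `ℝ³` onto the plane `N^⊥`. -/
noncomputable def proj (N : S2) : E3 →L[ℝ] perp N := (perp N).orthogonalProjectionOnto

theorem proj_add_smul (N : S2) (x : perp N) (z : ℝ) : proj N (x + z • (N : E3)) = x := by
  have h : proj N (N : E3) = 0 := by
    apply Submodule.orthogonalProjectionOnto_orthogonal_apply_eq_zero
    exact Submodule.mem_span_singleton_self _
  rw [map_add, map_smul, h]
  simp [proj]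

theorem inner_eq_inner_proj (N : S2) (x : perp N) (y : E3) :
    ⟪(x : E3), y⟫ = ⟪x, proj N y⟫ := by
  simp [proj]

theorem inner_perp (N : S2) (x : perp N) : ⟪(x : E3), (N : E3)⟫ = 0 := by
  have := x.2
  rw [Submodule.mem_orthogonal_singleton_iff_inner_left] at this
  exact this

theorem norm_sq_add_smul (N : S2) (x : perp N) (z : ℝ) :
    ‖(x : E3) + z • (N : E3)‖ ^ 2 = ‖x‖ ^ 2 + z ^ 2 := by
  rw [norm_add_sq_real, inner_smul_right, inner_perp, norm_smul]
  simp

theorem finrank_perp (N : S2) : Module.finrank ℝ (perp N) = 2 := by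
  have : Fact (Module.finrank ℝ E3 = 2 + 1) := ⟨by simp⟩
  exact Submodule.finrank_orthogonal_span_singleton (ne_zero_of_mem_unit_sphere N)

theorem lintegral_sq_div_sq_add_sq {a : ℝ} (ha : 0 ≤ a) :
    ∫⁻ z : ℝ, ENNReal.ofReal (a ^ 2 / (a ^ 2 + z ^ 2)) = ENNReal.ofReal (Real.pi * a) := by
  rcases ha.eq_or_lt with rfl | ha
  · simp
  have h : ∀ z : ℝ, ENNReal.ofReal (a ^ 2 / (a ^ 2 + z ^ 2)) =
      ENNReal.ofReal (1 + (a⁻¹ * z) ^ 2)⁻¹ := by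
    intro z
    congr 1
    field_simp
  simp_rw [h]
  rw [lintegral_comp_mul_left (fun z => ENNReal.ofReal (1 + z ^ 2)⁻¹) (by positivity),
    ← ofReal_integral_eq_lintegral_ofReal integrable_inv_one_add_sq
      (.of_forall fun z => by positivity), integral_univ_inv_one_add_sq, inv_inv, abs_of_pos ha,
    ← ENNReal.ofReal_mul ha.le, mul_comm]

/-- Polar coordinates seen through the projection to `N^⊥`: under `(ω, τ) ↦ τ ω'` the measure
`|ω'|² τ² dτ dω` becomes `π |ξ| dξ`. This is polar integration of `|ξ'|² |ξ|⁻² H(ξ')` over `ℝ³`,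
followed by integration in the direction of `N`. -/
theorem lintegral_sphere_proj (N : S2) {H : perp N → ℝ≥0∞} (hH : Measurable H) :
    ∫⁻ ω : S2, ‖proj N ω‖ₑ ^ 2 *
      (∫⁻ τ in Set.Ioi (0:ℝ), ENNReal.ofReal (τ ^ 2) * H (τ • proj N ω))
        ∂(volume : Measure E3).toSphere =
      ∫⁻ ξ : perp N, ENNReal.ofReal (Real.pi * ‖ξ‖) * H ξ ∂(lebesgue (perp N)) := by
  -- both sides compute the integral of `G` over `ℝ³`; the factor `π |ξ|` is the integral over `z`
  -- of `|ξ|² / (|ξ|² + z²)`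
  let G : E3 → ℝ≥0∞ := fun ξ => ENNReal.ofReal (‖proj N ξ‖ ^ 2 / ‖ξ‖ ^ 2) * H (proj N ξ)
  have hG : Measurable G := by fun_prop
  have h1 := (lintegral_polar hG).symm.trans (lintegral_perp_prod N hG)
  have h2 : ∀ ω : S2, ∫⁻ τ in Set.Ioi (0:ℝ), ENNReal.ofReal (τ ^ 2) * G (τ • (ω : E3)) =
      ‖proj N ω‖ₑ ^ 2 *
      (∫⁻ τ in Set.Ioi (0:ℝ), ENNReal.ofReal (τ ^ 2) * H (τ • proj N ω)) := by
    intro ω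
    rw [← lintegral_const_mul _ (by fun_prop)]
    refine setLIntegral_congr_fun measurableSet_Ioi fun τ hτ => ?_
    have hτ : τ ≠ 0 := ne_of_gt hτ
    have : ‖τ • proj N ω‖ ^ 2 / ‖τ • (ω : E3)‖ ^ 2 = ‖proj N ω‖ ^ 2 := by
      rw [norm_smul, norm_smul]
      simp
      field_simp
      rw [sq_abs, mul_comm]
    simp only [G, map_smul, this]
    rw [ENNReal.ofReal_pow (norm_nonneg _), ofReal_norm]
    ring
  have h3 : ∀ x : perp N, ∫⁻ z : ℝ, G (x + z • (N : E3)) = ENNReal.ofReal (Real.pi * ‖x‖) * H x := by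
    intro x
    simp only [G, proj_add_smul, norm_sq_add_smul]
    rw [lintegral_mul_const _ (by fun_prop), lintegral_sq_div_sq_add_sq (norm_nonneg _)]
  simp only [h2, h3] at h1
  exact h1

theorem lintegral_ball_inv_norm_lt_top :
    ∫⁻ x in Metric.ball (0 : EuclideanSpace ℝ (Fin 2)) 1, ‖x‖ₑ⁻¹ < ⊤ := by
  have h : IntegrableOn (fun x : EuclideanSpace ℝ (Fin 2) => ‖x‖⁻¹) (Metric.ball 0 1) := by
    rw [integrableOn_fun_norm_addHaar volume (f := fun y => y⁻¹)]
    refine (integrableOn_const (C := (1 : ℝ)) (by simp)).congr_fun ?_ measurableSet_Ioo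
    intro y hy
    simp [hy.1.ne']
  have h0 : ∀ᵐ x : EuclideanSpace ℝ (Fin 2), x ≠ 0 := by
    rw [ae_iff]; simp
  refine lt_of_le_of_lt (le_of_eq ?_) h.2
  refine lintegral_congr_ae (ae_restrict_of_ae ?_)
  filter_upwards [h0] with x hx
  rw [enorm_inv (by simpa using hx), enorm_norm]

theorem lintegral_ball_perp_inv_norm (N : S2) :
    ∫⁻ x in Metric.ball (0 : perp N) 1, ‖x‖ₑ⁻¹ ∂(lebesgue (perp N)) =
      ∫⁻ x in Metric.ball (0 : EuclideanSpace ℝ (Fin 2)) 1, ‖x‖ₑ⁻¹ := by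
  have : Fact (Module.finrank ℝ E3 = 2 + 1) := ⟨by simp⟩
  let e := (OrthonormalBasis.fromOrthogonalSpanSingleton (𝕜 := ℝ) 2
    (ne_zero_of_mem_unit_sphere N)).repr
  have h := e.measurePreserving.setLIntegral_comp_preimage
    (f := fun x => ‖x‖ₑ⁻¹) (Metric.isOpen_ball (x := 0) (ε := 1)).measurableSet (by fun_prop)
  rw [← h]
  have h2 : e ⁻¹' Metric.ball 0 1 = Metric.ball 0 1 := by ext x; simp
  rw [h2]
  refine lintegral_congr fun x => ?_
  simp [enorm_eq_nnnorm]

/-- The function `ω ↦ |ω'|⁻¹`, where `ω'` is the projection of `ω` to the plane `N^⊥`, is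
integrable over the sphere, uniformly in `N`. -/
theorem exists_lintegral_inv_proj_le : ∃ K : ℝ≥0, ∀ N : S2,
    ∫⁻ ω : S2, ‖proj N ω‖ₑ⁻¹ ∂(volume : Measure E3).toSphere ≤ K := by
  set I := ∫⁻ x in Metric.ball (0 : EuclideanSpace ℝ (Fin 2)) 1, ‖x‖ₑ⁻¹ with hI
  have hIfin : I ≠ ⊤ := lintegral_ball_inv_norm_lt_top.ne
  have key : ∀ N : S2, ENNReal.ofReal (1 / 2) *
      ∫⁻ ω : S2, ‖proj N ω‖ₑ⁻¹ ∂(volume : Measure E3).toSphere ≤ I * 2 := by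
    intro N
    -- in polar coordinates `∫ G` is `∫₀¹ τ dτ = 1 / 2` times the spherical integral; on the other
    -- hand `G` lives over the unit disc and on `|z| < 1`
    let G : E3 → ℝ≥0∞ := (Metric.ball (0 : E3) 1).indicator fun ξ => ‖proj N ξ‖ₑ⁻¹
    have hG : Measurable G := Measurable.indicator (by fun_prop) Metric.isOpen_ball.measurableSet
    have h1 := (lintegral_polar hG).symm.trans (lintegral_perp_prod N hG)
    have h2 : ∀ ω : S2, ENNReal.ofReal (1 / 2) * ‖proj N ω‖ₑ⁻¹ =
        ∫⁻ τ in Set.Ioi (0:ℝ), ENNReal.ofReal (τ ^ 2) * G (τ • (ω : E3)) := by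
      intro ω
      have h3 : ∫⁻ τ in Set.Ioo (0:ℝ) 1, ENNReal.ofReal τ = ENNReal.ofReal (1 / 2) := by
        rw [← ofReal_integral_eq_lintegral_ofReal, ← integral_Ioc_eq_integral_Ioo,
          ← intervalIntegral.integral_of_le zero_le_one, integral_id]
        · norm_num
        · exact (continuous_id.integrableOn_Icc).mono_set Set.Ioo_subset_Icc_self
        · filter_upwards [ae_restrict_mem measurableSet_Ioo] with τ hτ using hτ.1.le
      have h4 : Set.Ioi (0:ℝ) ∩ Set.Iio 1 = Set.Ioo 0 1 := rfl
      rw [← h3, ← lintegral_mul_const _ (by fun_prop), ← h4, Set.inter_comm,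
        ← setLIntegral_indicator measurableSet_Iio]
      refine setLIntegral_congr_fun measurableSet_Ioi fun τ hτ => ?_
      have hτ : 0 < τ := hτ
      have h5 : ‖τ • (ω : E3)‖ = τ := by rw [norm_smul]; simp [hτ.le]
      by_cases h6 : τ < 1
      · have h7 : ‖τ‖ₑ = ENNReal.ofReal τ := Real.enorm_eq_ofReal hτ.le
        have h8 : ENNReal.ofReal τ ≠ 0 := by simpa using hτ
        simp only [G, Set.indicator, Set.mem_Iio, h6, if_true, mem_ball_zero_iff, h5, map_smul,
          enorm_smul, h7, ENNReal.ofReal_pow hτ.le]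
        rw [ENNReal.mul_inv (Or.inl h8) (Or.inl ENNReal.ofReal_ne_top), sq, ← mul_assoc,
          mul_assoc (ENNReal.ofReal τ), ENNReal.mul_inv_cancel h8 ENNReal.ofReal_ne_top, mul_one]
      · simp [G, Set.indicator, h6, h5]
    rw [← lintegral_const_mul _ (by fun_prop)]
    simp_rw [h2]
    rw [h1, hI, ← lintegral_ball_perp_inv_norm N, ← lintegral_mul_const _ (by fun_prop),
      ← lintegral_indicator Metric.isOpen_ball.measurableSet]
    refine lintegral_mono fun x => ?_
    have h9 : ∀ z : ℝ, G (x + z • (N : E3)) ≤ (Set.Ioo (-1:ℝ) 1).indicator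
        (fun _ => (Metric.ball (0 : perp N) 1).indicator (fun x => ‖x‖ₑ⁻¹) x) z := by
      intro z
      simp only [G, Set.indicator, proj_add_smul, mem_ball_zero_iff]
      split_ifs with ha hb hc hc
      · exact le_rfl
      · have := norm_sq_add_smul N x z
        exfalso; apply hc
        nlinarith [norm_nonneg x, sq_nonneg z, norm_nonneg ((x : E3) + z • (N : E3))]
      · have := norm_sq_add_smul N x z
        exfalso; apply hb
        constructor <;>
        nlinarith [norm_nonneg x, sq_nonneg ‖x‖, norm_nonneg ((x : E3) + z • (N : E3))]
      all_goals simp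
    refine (lintegral_mono h9).trans ?_
    rw [lintegral_indicator measurableSet_Ioo, setLIntegral_const, Real.volume_Ioo]
    by_cases hx : x ∈ Metric.ball (0 : perp N) 1
    · simp only [hx, Set.indicator_of_mem]
      norm_num
    · simp [hx]
  refine ⟨(2 * (I * 2)).toNNReal, fun N => ?_⟩
  rw [ENNReal.coe_toNNReal (by finiteness)]
  have := mul_le_mul_right (key N) 2
  rw [← mul_assoc] at this
  have h2 : (2:ℝ≥0∞) * ENNReal.ofReal (1/2) = 1 := by
    rw [← ENNReal.ofReal_ofNat, ← ENNReal.ofReal_mul (by norm_num)]; norm_num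
  rwa [h2, one_mul] at this

/-! ### The regularised transform of a function on a plane -/

instance {F : Type*} [NormedAddCommGroup F] [InnerProductSpace ℝ F] [FiniteDimensional ℝ F]
    [MeasurableSpace F] [BorelSpace F] : (lebesgue F).IsAddHaarMeasure :=
  inferInstanceAs (volume : Measure F).IsAddHaarMeasure

theorem integrableOn_mul_exp_neg {ε : ℝ} (hε : 0 < ε) (n : ℕ) :
    IntegrableOn (fun τ : ℝ => τ ^ n * Real.exp (-ε * τ)) (Set.Ioi 0) := by
  have := integrableOn_rpow_mul_exp_neg_mul_rpow (s := n) (p := 1) (b := ε)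
    (by have : (0:ℝ) ≤ n := n.cast_nonneg
        linarith) one_pos hε
  simpa using this

theorem integral_mul_exp_Ioi {ε : ℝ} (hε : 0 < ε) (s : ℝ) :
    ∫ τ in Set.Ioi (0:ℝ), ((τ * Real.exp (-ε * τ) : ℝ) : ℂ) * Complex.exp (Complex.I * s * τ) =
      1 / ((ε : ℂ) - Complex.I * s) ^ 2 := by
  set c : ℂ := (ε : ℂ) - Complex.I * s with hc
  have hcre : c.re = ε := by simp [hc]
  have hc0 : c ≠ 0 := by
    intro h
    rw [h] at hcre
    exact hε.ne hcre
  have hexp : ∀ τ : ℝ, ((τ * Real.exp (-ε * τ) : ℝ) : ℂ) * Complex.exp (Complex.I * s * τ) =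
      τ * Complex.exp (-c * τ) := by
    intro τ
    push_cast
    rw [mul_assoc, ← Complex.exp_add]
    congr 2
    rw [hc]
    ring
  have hderiv : ∀ τ : ℝ, HasDerivAt
      (fun τ : ℝ => -((τ : ℂ) / c + 1 / c ^ 2) * Complex.exp (-c * τ))
      (τ * Complex.exp (-c * τ)) τ := by
    intro τ
    have h1 : HasDerivAt (fun τ : ℝ => (τ : ℂ)) 1 τ := Complex.ofRealCLM.hasDerivAt
    convert! ((h1.div_const c).add_const (1 / c ^ 2)).neg.mul (h1.const_mul (-c)).cexp using 1
    simp only [Pi.neg_apply]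
    field_simp
    ring
  have hlim : Filter.Tendsto (fun τ : ℝ => -((τ : ℂ) / c + 1 / c ^ 2) * Complex.exp (-c * τ))
      Filter.atTop (nhds 0) := by
    have h1 := tendsto_rpow_mul_exp_neg_mul_atTop_nhds_zero 1 ε hε
    have h0 := tendsto_rpow_mul_exp_neg_mul_atTop_nhds_zero 0 ε hε
    have h2 := (h1.mul_const (‖c‖⁻¹)).add (h0.mul_const (‖c ^ 2‖⁻¹))
    simp only [zero_mul, add_zero] at h2
    refine squeeze_zero_norm' ?_ h2
    filter_upwards [Filter.eventually_ge_atTop 0] with τ hτ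
    rw [norm_mul, norm_neg, Complex.norm_exp]
    have h3 : (-c * (τ : ℂ)).re = -ε * τ := by simp [hcre]
    have h4 : ‖(τ : ℂ) / c + 1 / c ^ 2‖ ≤ τ * ‖c‖⁻¹ + ‖c ^ 2‖⁻¹ := by
      refine (norm_add_le _ _).trans ?_
      rw [norm_div, norm_div, norm_one, Complex.norm_real, Real.norm_of_nonneg hτ, one_div,
        div_eq_mul_inv]
    rw [h3, Real.rpow_one, Real.rpow_zero]
    refine (mul_le_mul_of_nonneg_right h4 (Real.exp_pos _).le).trans (le_of_eq ?_)
    ring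
  simp_rw [hexp]
  have hint : IntegrableOn (fun τ : ℝ => (τ : ℂ) * Complex.exp (-c * τ)) (Set.Ioi 0) := by
    refine (integrableOn_mul_exp_neg hε 1).mono' (by fun_prop) ?_
    filter_upwards [ae_restrict_mem measurableSet_Ioi] with τ hτ
    have hτ : 0 < τ := hτ
    rw [norm_mul, Complex.norm_exp, Complex.norm_real, Real.norm_of_nonneg hτ.le]
    simp [hcre]
  rw [integral_Ioi_of_hasDerivAt_of_tendsto' (fun τ _ => hderiv τ) hint hlim]
  simp

section
variable {F : Type*} [NormedAddCommGroup F] [InnerProductSpace ℝ F] [FiniteDimensional ℝ F]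
  [MeasurableSpace F] [BorelSpace F]

/-- The regularised transform `∫ f(x) (ε - i (⟪x, y⟫ + a))⁻² dx` of a function `f` on a Euclidean
space. It equals `∫₀^∞ τ e^{-ετ} e^{iaτ} (∫ e^{i⟪x, y⟫τ} f(x) dx) dτ`, see `regL_eq`. -/
noncomputable def regL (ε : ℝ) (f : F → ℂ) (y : F) (a : ℝ) : ℂ :=
  ∫ x, f x * (1 / ((ε : ℂ) - Complex.I * (⟪x, y⟫ + a : ℝ)) ^ 2) ∂(lebesgue F)

theorem fourier_neg_smul (f : F → ℂ) (y : F) (τ : ℝ) :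
    𝓕 f (-(τ / (2 * Real.pi)) • y) =
      ∫ x, Complex.exp (Complex.I * (⟪x, y⟫ : ℝ) * τ) * f x ∂(lebesgue F) := by
  rw [Real.fourier_eq']
  refine integral_congr_ae (.of_forall fun x => ?_)
  have := Real.pi_ne_zero
  simp only [smul_eq_mul, inner_smul_right]
  congr 2
  push_cast
  field_simp

theorem continuous_fourier {f : F → ℂ} (hf : Integrable f (lebesgue F)) : Continuous (𝓕 f) :=
  VectorFourier.fourierIntegral_continuous Real.continuous_fourierChar continuous_inner hf

theorem norm_fourier_le (f : F → ℂ) (ξ : F) : ‖𝓕 f ξ‖ ≤ ∫ x, ‖f x‖ ∂(lebesgue F) :=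
  VectorFourier.norm_fourierIntegral_le_integral_norm _ _ _ _ _

/-- The regularised transform is the `τ`-integral of the Fourier transform of `f` along the ray
through `-y`, with the convergence factor `e^{-ετ}`. -/
theorem regL_eq {ε : ℝ} (hε : 0 < ε) {f : F → ℂ} (hf : Integrable f (lebesgue F)) (y : F) (a : ℝ) :
    regL ε f y a = ∫ τ in Set.Ioi (0:ℝ), ((τ * Real.exp (-ε * τ) : ℝ) : ℂ) *
      𝓕 f (-(τ / (2 * Real.pi)) • y) * Complex.exp (Complex.I * a * τ) := by
  -- absolute integrability of the double integral, which the factor `e^{-ετ}` provides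
  have hint : Integrable (fun p : F × ℝ => f p.1 * (((p.2 * Real.exp (-ε * p.2) : ℝ) : ℂ) *
      Complex.exp (Complex.I * (⟪p.1, y⟫ + a : ℝ) * p.2)))
      ((lebesgue F).prod (volume.restrict (Set.Ioi 0))) := by
    have h1 : Integrable (fun p : F × ℝ => f p.1 * ((p.2 * Real.exp (-ε * p.2) : ℝ) : ℂ))
      ((lebesgue F).prod (volume.restrict (Set.Ioi 0))) := by
      refine hf.mul_prod (g := fun τ => ((τ * Real.exp (-ε * τ) : ℝ) : ℂ)) ?_
      have := (integrableOn_mul_exp_neg hε 1).ofReal (𝕜 := ℂ)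
      simpa using this
    have h2 := h1.bdd_mul (c := 1) (f := fun p : F × ℝ =>
      Complex.exp (Complex.I * (⟪p.1, y⟫ + a : ℝ) * p.2))
      (Continuous.aestronglyMeasurable (by fun_prop)) (.of_forall fun p => ?_)
    · refine h2.congr (.of_forall fun p => ?_)
      simp only []
      ring
    · rw [Complex.norm_exp]
      simp
  unfold regL
  simp_rw [← integral_mul_exp_Ioi hε, ← integral_const_mul]
  rw [integral_integral_swap hint]
  refine setIntegral_congr_fun measurableSet_Ioi fun τ hτ => ?_
  rw [fourier_neg_smul, mul_assoc, ← integral_mul_const, ← integral_const_mul]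
  refine integral_congr_ae (.of_forall fun x => ?_)
  simp only
  have : Complex.exp (Complex.I * (⟪x, y⟫ + a : ℝ) * τ) =
      Complex.exp (Complex.I * (⟪x, y⟫ : ℝ) * τ) * Complex.exp (Complex.I * a * τ) := by
    rw [← Complex.exp_add]
    push_cast
    ring_nf
  rw [this]
  ring

/-- The `L²` bound of the regularised transform in `r`, uniform in `ε`, by Plancherel's theorem. -/
theorem lintegral_regL_sq_le {ε : ℝ} (hε : 0 < ε) {f : F → ℂ} (hf : Integrable f (lebesgue F))
    (y : F) :
    ∫⁻ r : ℝ, ‖regL ε f y (r / 2)‖ₑ ^ 2 ≤ ENNReal.ofReal (4 * Real.pi) *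
      ∫⁻ τ in Set.Ioi (0:ℝ), ENNReal.ofReal (τ ^ 2) * ‖𝓕 f (-(τ / (2 * Real.pi)) • y)‖ₑ ^ 2 := by
  set g : ℝ → ℂ := fun τ => ((τ * Real.exp (-ε * τ) : ℝ) : ℂ) *
      𝓕 f (-(τ / (2 * Real.pi)) • y) with hg
  have hgc : Continuous g := by
    have := continuous_fourier hf
    fun_prop
  have hgb : ∀ τ, ‖g τ‖ ≤ |τ * Real.exp (-ε * τ)| * ∫ x, ‖f x‖ ∂(lebesgue F) := by
    intro τ
    rw [hg]
    simp only [norm_mul, Complex.norm_real]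
    gcongr
    · simp
    · exact norm_fourier_le _ _
  have h1 : Integrable ((Set.Ioi (0:ℝ)).indicator g) := by
    rw [integrable_indicator_iff measurableSet_Ioi]
    have h := ((integrableOn_mul_exp_neg hε 1).norm.mul_const (∫ x, ‖f x‖ ∂(lebesgue F)))
    refine h.mono' hgc.aestronglyMeasurable (.of_forall fun τ => ?_)
    simpa using hgb τ
  have h2 : MemLp ((Set.Ioi (0:ℝ)).indicator g) 2 := by
    rw [memLp_indicator_iff_restrict measurableSet_Ioi,
      memLp_two_iff_integrable_sq_norm hgc.aestronglyMeasurable]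
    have h := ((integrableOn_mul_exp_neg (ε := 2 * ε) (by positivity) 2).mul_const
      ((∫ x, ‖f x‖ ∂(lebesgue F)) ^ 2))
    refine h.mono' (by fun_prop) (.of_forall fun τ => ?_)
    rw [Real.norm_of_nonneg (by positivity)]
    refine (pow_le_pow_left₀ (norm_nonneg _) (hgb τ) 2).trans (le_of_eq ?_)
    rw [mul_pow, sq_abs, mul_pow, ← Real.exp_nat_mul]
    ring_nf
  have h3 := lintegral_enorm_sq_integral_exp h1 h2
  have h4 : ∀ r : ℝ, ∫ τ, (Set.Ioi (0:ℝ)).indicator g τ * Complex.exp (Complex.I / 2 * r * τ) =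
      regL ε f y (r / 2) := by
    intro r
    rw [regL_eq hε hf, ← integral_indicator measurableSet_Ioi]
    refine integral_congr_ae (.of_forall fun τ => ?_)
    by_cases hτ : τ ∈ Set.Ioi (0:ℝ)
    · simp only [Set.indicator_of_mem hτ, hg]
      congr 2
      push_cast
      ring
    · simp [Set.indicator_of_notMem hτ]
  simp_rw [h4] at h3
  rw [h3]
  refine mul_le_mul_right ?_ _
  rw [← lintegral_indicator measurableSet_Ioi]
  refine lintegral_mono fun τ => ?_
  by_cases hτ : τ ∈ Set.Ioi (0:ℝ)
  · simp only [Set.indicator_of_mem hτ, hg]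
    have hτ : 0 < τ := hτ
    rw [enorm_mul, mul_pow]
    gcongr
    rw [← ofReal_norm, ← ENNReal.ofReal_pow (norm_nonneg _), Complex.norm_real,
      Real.norm_of_nonneg (by positivity)]
    apply ENNReal.ofReal_le_ofReal
    have : Real.exp (-ε * τ) ≤ 1 := Real.exp_le_one_iff.2 (by nlinarith)
    have h0 := Real.exp_pos (-ε * τ)
    gcongr
    nlinarith
  · simp [Set.indicator_of_notMem hτ]

/-- For `|r| > 4 R |y|` one has `|⟪x, y⟫ + r / 2| ≥ |r| / 4` on the support of `f`, so that the
kernel is bounded by `16 r⁻²`, uniformly in `ε`. -/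
theorem enorm_regL_le (ε : ℝ) {f : F → ℂ} {R : ℝ}
    (hR : ∀ x, R < ‖x‖ → f x = 0) (y : F) {r : ℝ} (hr : 4 * R * ‖y‖ < |r|) (hr0 : r ≠ 0) :
    ‖regL ε f y (r / 2)‖ₑ ≤ ENNReal.ofReal (16 * (r ^ 2)⁻¹) * ∫⁻ x, ‖f x‖ₑ ∂(lebesgue F) := by
  refine (enorm_integral_le_lintegral_enorm _).trans ?_
  rw [← lintegral_const_mul' _ _ (by finiteness)]
  refine lintegral_mono fun x => ?_
  rw [enorm_mul, mul_comm]
  by_cases hx : R < ‖x‖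
  · simp [hR x hx]
  gcongr
  push Not at hx
  rw [← ofReal_norm]
  apply ENNReal.ofReal_le_ofReal
  have hin : |⟪x, y⟫| ≤ R * ‖y‖ := (abs_real_inner_le_norm x y).trans (by gcongr)
  have h1 : |r| / 4 ≤ |⟪x, y⟫ + r / 2| := by
    have h2 := abs_sub_abs_le_abs_sub (r / 2) (-⟪x, y⟫)
    rw [abs_neg, sub_neg_eq_add, abs_div, add_comm (r / 2)] at h2
    norm_num at h2
    linarith
  have h3 : |r| / 4 ≤ ‖(ε : ℂ) - Complex.I * (⟪x, y⟫ + r / 2 : ℝ)‖ := by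
    refine h1.trans ?_
    have := Complex.abs_im_le_norm ((ε : ℂ) - Complex.I * (⟪x, y⟫ + r / 2 : ℝ))
    have him : ((ε : ℂ) - Complex.I * (⟪x, y⟫ + r / 2 : ℝ)).im = -(⟪x, y⟫ + r / 2) := by
      rw [Complex.sub_im, Complex.ofReal_im, Complex.I_mul_im, Complex.ofReal_re, zero_sub]
    rwa [him, abs_neg] at this
  have hr' : 0 < |r| := abs_pos.2 hr0
  rw [norm_div, norm_one, norm_pow, ← sq_abs r]
  calc 1 / ‖(ε : ℂ) - Complex.I * (⟪x, y⟫ + r / 2 : ℝ)‖ ^ 2 ≤ 1 / (|r| / 4) ^ 2 := by gcongr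
    _ = 16 * (|r| ^ 2)⁻¹ := by field_simp; norm_num

end

/-! ### Local and tail estimates, and a Poincaré inequality -/

theorem lintegral_mul_le_sqrt {α : Type*} [MeasurableSpace α] (μ : Measure α) {f g : α → ℝ≥0∞}
    (hf : AEMeasurable f μ) (hg : AEMeasurable g μ) :
    ∫⁻ a, f a * g a ∂μ ≤
      (∫⁻ a, f a ^ 2 ∂μ) ^ (1 / 2 : ℝ) * (∫⁻ a, g a ^ 2 ∂μ) ^ (1 / 2 : ℝ) := by
  have := ENNReal.lintegral_mul_le_Lp_mul_Lq μ Real.HolderConjugate.two_two hf hg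
  simpa using this

theorem setLIntegral_le_sqrt {α : Type*} [MeasurableSpace α] (μ : Measure α) {f : α → ℝ≥0∞}
    (hf : AEMeasurable f μ) (s : Set α) :
    ∫⁻ a in s, f a ∂μ ≤ μ s ^ (1 / 2 : ℝ) * (∫⁻ a in s, f a ^ 2 ∂μ) ^ (1 / 2 : ℝ) := by
  have := lintegral_mul_le_sqrt (μ.restrict s) (f := fun _ => 1) aemeasurable_const hf.restrict
  simpa using this

section
variable {F : Type*} [NormedAddCommGroup F] [InnerProductSpace ℝ F] [FiniteDimensional ℝ F]
  [MeasurableSpace F] [BorelSpace F]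

theorem measurable_regL (ε : ℝ) {f : F → ℂ} (hf : Continuous f) :
    Measurable fun p : F × ℝ => regL ε f p.1 p.2 := by
  have h : Measurable fun q : (F × ℝ) × F =>
      f q.2 * (1 / ((ε : ℂ) - Complex.I * (⟪q.2, q.1.1⟫ + q.1.2 : ℝ)) ^ 2) := by
    fun_prop
  exact (h.stronglyMeasurable.integral_prod_right' (ν := lebesgue F)).measurable

/-- The `L¹` norm of the regularised transform in `r` does not see a shift of its last argument. -/
theorem lintegral_regL_add (ε : ℝ) (f : F → ℂ) (y : F) (b : ℝ) :
    ∫⁻ r : ℝ, ‖regL ε f y (b + r / 2)‖ₑ = ∫⁻ r : ℝ, ‖regL ε f y (r / 2)‖ₑ := by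
  rw [← lintegral_add_right_eq_self (fun r : ℝ => ‖regL ε f y (r / 2)‖ₑ) (2 * b)]
  refine lintegral_congr fun r => ?_
  congr 2
  ring

/-- The `L¹` norm in `r` of the regularised transform: Cauchy-Schwarz and the `L²` bound on
`|r| ≤ 4 R |y|`, the pointwise decay outside. -/
theorem lintegral_regL_le {ε : ℝ} (hε : 0 < ε) {f : F → ℂ} (hfc : Continuous f)
    (hf : Integrable f (lebesgue F)) {R : ℝ} (hR0 : 0 < R)
    (hR : ∀ x, R < ‖x‖ → f x = 0) {y : F} (hy : y ≠ 0) :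
    ∫⁻ r : ℝ, ‖regL ε f y (r / 2)‖ₑ ≤
      (ENNReal.ofReal (8 * R) * ‖y‖ₑ) ^ (1 / 2 : ℝ) * (ENNReal.ofReal (4 * Real.pi) *
        ∫⁻ τ in Set.Ioi (0:ℝ), ENNReal.ofReal (τ ^ 2) *
          ‖𝓕 f (-(τ / (2 * Real.pi)) • y)‖ₑ ^ 2) ^ (1 / 2 : ℝ) +
      ENNReal.ofReal (8 * Real.pi / R) * ‖y‖ₑ⁻¹ * ∫⁻ x, ‖f x‖ₑ ∂(lebesgue F) := by
  have hy' : 0 < ‖y‖ := norm_pos_iff.2 hy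
  -- outside `[-A, A]` the kernel decays like `r⁻²`
  set A : ℝ := 4 * R * ‖y‖ with hA
  have hA0 : 0 < A := by positivity
  have hm : Measurable fun r : ℝ => ‖regL ε f y (r / 2)‖ₑ := by
    have : Measurable fun r : ℝ => (y, r / 2) := by fun_prop
    exact ((measurable_regL ε hfc).comp this).enorm
  rw [← lintegral_add_compl _ (measurableSet_Icc (a := -A) (b := A))]
  gcongr
  · refine (setLIntegral_le_sqrt _ hm.aemeasurable _).trans ?_
    gcongr
    · rw [Real.volume_Icc, ← ofReal_norm, ← ENNReal.ofReal_mul (by positivity)]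
      apply ENNReal.ofReal_le_ofReal
      rw [hA]; linarith
    · exact (setLIntegral_le_lintegral _ _).trans (lintegral_regL_sq_le hε hf y)
  · -- `r⁻² ≤ 2 (A² + r²)⁻¹` for `|r| ≥ A`, and the right-hand side is integrable over all of `ℝ`
    have h1 : ∀ r ∈ (Set.Icc (-A) A)ᶜ, ‖regL ε f y (r / 2)‖ₑ ≤
        ENNReal.ofReal (32 / A ^ 2) * (∫⁻ x, ‖f x‖ₑ ∂(lebesgue F)) *
          ENNReal.ofReal (A ^ 2 / (A ^ 2 + r ^ 2)) := by
      intro r hr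
      have hr : A < |r| := by
        by_contra! h
        exact hr (abs_le.1 h)
      have hr0 : r ≠ 0 := by
        rintro rfl
        rw [abs_zero] at hr
        exact hA0.not_gt hr
      refine (enorm_regL_le ε hR y hr hr0).trans ?_
      rw [mul_right_comm, ← ENNReal.ofReal_mul (by positivity)]
      refine mul_le_mul_left (ENNReal.ofReal_le_ofReal ?_) _
      have h2 : A ^ 2 < r ^ 2 := by
        rw [← sq_abs r]; gcongr
      have : 32 / A ^ 2 * (A ^ 2 / (A ^ 2 + r ^ 2)) = 32 / (A ^ 2 + r ^ 2) := by field_simp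
      rw [this, ← div_eq_mul_inv, div_le_div_iff₀ (by positivity) (by positivity)]
      linarith
    refine (setLIntegral_mono (by fun_prop) h1).trans ?_
    refine (setLIntegral_le_lintegral _ _).trans ?_
    rw [lintegral_const_mul _ (by fun_prop), lintegral_sq_div_sq_add_sq hA0.le, mul_right_comm,
      ← ENNReal.ofReal_mul (by positivity)]
    gcongr
    rw [← ofReal_norm, ← ENNReal.ofReal_inv_of_pos hy', ← ENNReal.ofReal_mul (by positivity)]
    apply ENNReal.ofReal_le_ofReal
    rw [hA]
    apply le_of_eq
    field_simp
    norm_num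

theorem lebesgue_closedBall (hF : Module.finrank ℝ F = 2) {R : ℝ} (hR : 0 ≤ R) (x : F) :
    lebesgue F (Metric.closedBall x R) = ENNReal.ofReal (Real.pi * R ^ 2) := by
  have : Nontrivial F := Module.nontrivial_of_finrank_pos (R := ℝ) (by omega)
  have := InnerProductSpace.volume_closedBall_of_dim_even (k := 1) (by rw [hF]) x R
  rw [lebesgue, this, ← ENNReal.ofReal_pow hR, ← ENNReal.ofReal_mul (by positivity)]
  congr 1
  rw [hF]
  simp
  ring

theorem sq_lintegral_enorm_le (hF : Module.finrank ℝ F = 2) {f : F → ℂ} (hfc : Continuous f)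
    {R : ℝ} (hR0 : 0 ≤ R) (hR : ∀ x, R < ‖x‖ → f x = 0) :
    (∫⁻ x, ‖f x‖ₑ ∂(lebesgue F)) ^ 2 ≤
      ENNReal.ofReal (Real.pi * R ^ 2) * ∫⁻ x, ‖f x‖ₑ ^ 2 ∂(lebesgue F) := by
  have h1 : ∫⁻ x, ‖f x‖ₑ ∂(lebesgue F) = ∫⁻ x in Metric.closedBall 0 R, ‖f x‖ₑ ∂(lebesgue F) := by
    rw [setLIntegral_eq_of_support_subset]
    intro x hx
    rw [mem_closedBall_zero_iff]
    by_contra! h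
    simp [hR x h] at hx
  have h2 := setLIntegral_le_sqrt (lebesgue F) (f := fun x => ‖f x‖ₑ) (by fun_prop)
    (Metric.closedBall 0 R)
  rw [h1]
  refine (pow_le_pow_left' h2 2).trans ?_
  rw [mul_pow, ← ENNReal.rpow_natCast, ← ENNReal.rpow_natCast, ← ENNReal.rpow_mul,
    ← ENNReal.rpow_mul, lebesgue_closedBall hF hR0]
  norm_num
  gcongr
  exact Measure.restrict_le_self

/-- A Poincaré inequality: `‖f‖²_{L²} ≤ 2 R ‖f‖²_{Ḣ^{1/2}}` for `f` supported in a disc of radius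
`R`. Because `|f^| ≤ ‖f‖_{L¹} ≲ R ‖f‖_{L²}`, the frequencies below `(2 π R)⁻¹` carry at most a quarter
of the mass of `f^`, and on the remaining ones `1 ≤ R (2 π |ξ|)`. -/
theorem lintegral_enorm_sq_le (hF : Module.finrank ℝ F = 2) {f : F → ℂ} (hfc : Continuous f)
    (hf : Integrable f (lebesgue F)) (hf2 : MemLp f 2 (lebesgue F))
    {R : ℝ} (hR0 : 0 < R) (hR : ∀ x, R < ‖x‖ → f x = 0) :
    ∫⁻ x, ‖f x‖ₑ ^ 2 ∂(lebesgue F) ≤ ENNReal.ofReal (2 * R) *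
      ∫⁻ ξ, ENNReal.ofReal (2 * Real.pi * ‖ξ‖) * ‖𝓕 f ξ‖ₑ ^ 2 ∂(lebesgue F) := by
  set A := ∫⁻ x, ‖f x‖ₑ ^ 2 ∂(lebesgue F) with hA
  set H := ∫⁻ ξ, ENNReal.ofReal (2 * Real.pi * ‖ξ‖) * ‖𝓕 f ξ‖ₑ ^ 2 ∂(lebesgue F) with hH
  have hpi := Real.pi_pos
  have hAtop : A ≠ ⊤ := by
    have := hf2.integrable_norm_pow (by norm_num)
    have h2 := this.2.ne
    simpa [hA, enorm_pow, HasFiniteIntegral] using h2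
  have hmeas : Measurable (𝓕 f) := (continuous_fourier hf).measurable
  have hpl : ∫⁻ ξ, ‖𝓕 f ξ‖ₑ ^ 2 ∂(lebesgue F) = A := lintegral_enorm_sq_fourier hf hf2
  -- the disc of radius `η` has area `π η² = (4 π R²)⁻¹`, so it carries at most a quarter of `‖f‖²`
  set η : ℝ := (2 * Real.pi * R)⁻¹ with hη
  have hη0 : 0 < η := by positivity
  have hb : ∀ ξ, ‖𝓕 f ξ‖ₑ ≤ ∫⁻ x, ‖f x‖ₑ ∂(lebesgue F) := by
    intro ξ
    rw [← ofReal_norm, ← ofReal_integral_norm_eq_lintegral_enorm hf]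
    exact ENNReal.ofReal_le_ofReal (norm_fourier_le f ξ)
  have h1 : ∫⁻ ξ in Metric.closedBall 0 η, ‖𝓕 f ξ‖ₑ ^ 2 ∂(lebesgue F) ≤
      ENNReal.ofReal (1 / 4) * A := by
    calc _ ≤ ∫⁻ ξ in Metric.closedBall 0 η, ENNReal.ofReal (Real.pi * R ^ 2) * A ∂(lebesgue F) := by
          refine lintegral_mono fun ξ => ?_
          exact (pow_le_pow_left' (hb ξ) 2).trans (sq_lintegral_enorm_le hF hfc hR0.le hR)
      _ = ENNReal.ofReal (1 / 4) * A := by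
          rw [setLIntegral_const, lebesgue_closedBall hF hη0.le, mul_right_comm,
            ← ENNReal.ofReal_mul (by positivity)]
          congr 2
          rw [hη]
          field_simp
          norm_num
  have h2 : ∫⁻ ξ in (Metric.closedBall 0 η)ᶜ, ‖𝓕 f ξ‖ₑ ^ 2 ∂(lebesgue F) ≤
      ENNReal.ofReal R * H := by
    rw [hH, ← lintegral_const_mul _ (by fun_prop)]
    refine (setLIntegral_mono (by fun_prop) fun ξ hξ => ?_).trans (setLIntegral_le_lintegral _ _)
    have hξ : η < ‖ξ‖ := by simpa using hξ
    rw [← mul_assoc, ← ENNReal.ofReal_mul hR0.le]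
    refine le_mul_of_one_le_left (zero_le) ?_
    rw [← ENNReal.ofReal_one]
    apply ENNReal.ofReal_le_ofReal
    calc 1 = R * (2 * Real.pi * η) := by rw [hη]; field_simp
      _ ≤ _ := by gcongr
  have h3 : A ≤ ENNReal.ofReal (1 / 4) * A + ENNReal.ofReal R * H := by
    calc A = _ := hpl.symm
      _ = _ := (lintegral_add_compl _ Metric.isClosed_closedBall.measurableSet).symm
      _ ≤ _ := add_le_add h1 h2
  -- since `A` is finite, the term `A / 4` can be absorbed in the left-hand side
  clear_value A H
  rcases eq_or_ne H ⊤ with hHt | hHt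
  · rw [hHt, ENNReal.mul_top (by simpa using hR0)]
    exact le_top
  · lift A to ℝ≥0 using hAtop
    lift H to ℝ≥0 using hHt
    have h4 := ENNReal.toReal_mono (by finiteness) h3
    rw [ENNReal.toReal_add (by finiteness) (by finiteness), ENNReal.toReal_mul, ENNReal.toReal_mul,
      ENNReal.toReal_ofReal (by norm_num), ENNReal.toReal_ofReal hR0.le] at h4
    rw [← ENNReal.ofReal_coe_nnreal (p := A), ← ENNReal.ofReal_coe_nnreal (p := H),
      ← ENNReal.ofReal_mul (by positivity)]
    apply ENNReal.ofReal_le_ofReal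
    simp only [ENNReal.coe_toReal] at h4
    nlinarith [H.2, A.2, mul_nonneg hR0.le H.2]

end

/-! ### The regularised transform and the homogeneous Sobolev norm -/

/-- The weighted spherical average of `∫ τ² |f^(τ ω')|² dτ` is a multiple of the square of the
`Ḣ^{1/2}` norm of `f`. -/
theorem lintegral_sphere_fourier (N : S2) {f : perp N → ℂ} (hf : Integrable f (lebesgue (perp N))) :
    ∫⁻ ω : S2, ‖proj N ω‖ₑ ^ 2 * (∫⁻ τ in Set.Ioi (0:ℝ), ENNReal.ofReal (τ ^ 2) *
        ‖𝓕 f (-(τ / (2 * Real.pi)) • proj N ω)‖ₑ ^ 2) ∂(volume : Measure E3).toSphere =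
      ENNReal.ofReal (4 * Real.pi ^ 3) *
        ∫⁻ ξ, ENNReal.ofReal (2 * Real.pi * ‖ξ‖) * ‖𝓕 f ξ‖ₑ ^ 2 ∂(lebesgue (perp N)) := by
  have hmeas : Measurable (𝓕 f) := (continuous_fourier hf).measurable
  have hpi := Real.pi_pos
  set c : ℝ := -(1 / (2 * Real.pi)) with hc
  have hc0 : c ≠ 0 := by rw [hc]; simp [hpi.ne']
  have h := lintegral_sphere_proj N (H := fun ξ => ‖𝓕 f (c • ξ)‖ₑ ^ 2) (by fun_prop)
  have h1 : ∀ (τ : ℝ) (y : perp N), c • τ • y = -(τ / (2 * Real.pi)) • y := by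
    intro τ y
    rw [smul_smul, hc]
    congr 1
    ring
  simp_rw [h1] at h
  rw [h]
  let G : perp N → ℝ≥0∞ := fun η =>
    ENNReal.ofReal Real.pi * (ENNReal.ofReal (2 * Real.pi * ‖η‖) * ‖𝓕 f η‖ₑ ^ 2)
  have h2 : ∀ ξ : perp N, ENNReal.ofReal (Real.pi * ‖ξ‖) * ‖𝓕 f (c • ξ)‖ₑ ^ 2 = G (c • ξ) := by
    intro ξ
    simp only [G]
    rw [← mul_assoc, ← ENNReal.ofReal_mul hpi.le, norm_smul, hc, norm_neg,
      Real.norm_of_nonneg (by positivity)]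
    congr 3
    field_simp
  rw [lintegral_congr h2, lintegral_comp_smul (lebesgue (perp N)) G hc0]
  simp only [G]
  rw [lintegral_const_mul _ (by fun_prop), ← mul_assoc, ← ENNReal.ofReal_mul (by positivity),
    finrank_perp]
  congr 2
  rw [hc, abs_of_pos (by positivity)]
  field_simp
  ring

theorem homSobolevHalf_def {F : Type*} [NormedAddCommGroup F] [InnerProductSpace ℝ F]
    [FiniteDimensional ℝ F] [MeasurableSpace F] [BorelSpace F] (f : F → ℂ) :
    (∫⁻ ξ, ENNReal.ofReal (2 * Real.pi * ‖ξ‖) * ‖𝓕 f ξ‖ₑ ^ 2 ∂(lebesgue F)) ^ (1 / 2 : ℝ) =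
      homSobolevHalf f := rfl

theorem ofReal_rpow_half {x : ℝ} (hx : 0 ≤ x) :
    ENNReal.ofReal x ^ (1 / 2 : ℝ) = ENNReal.ofReal √x := by
  rw [ENNReal.ofReal_rpow_of_nonneg hx (by norm_num), Real.sqrt_eq_rpow]

theorem rpow_half_sq (a : ℝ≥0∞) : (a ^ (1 / 2 : ℝ)) ^ 2 = a := by
  rw [← ENNReal.rpow_natCast, ← ENNReal.rpow_mul]
  norm_num

theorem sq_rpow_half (a : ℝ≥0∞) : (a ^ 2) ^ (1 / 2 : ℝ) = a := by
  rw [← ENNReal.rpow_natCast, ← ENNReal.rpow_mul]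
  norm_num

theorem lintegral_enorm_le_homSobolevHalf {F : Type*} [NormedAddCommGroup F]
    [InnerProductSpace ℝ F] [FiniteDimensional ℝ F] [MeasurableSpace F] [BorelSpace F]
    (hF : Module.finrank ℝ F = 2) {f : F → ℂ} (hfc : Continuous f)
    (hf : Integrable f (lebesgue F)) (hf2 : MemLp f 2 (lebesgue F))
    {R : ℝ} (hR0 : 0 < R) (hR : ∀ x, R < ‖x‖ → f x = 0) :
    ∫⁻ x, ‖f x‖ₑ ∂(lebesgue F) ≤
      ENNReal.ofReal (√(2 * Real.pi) * √R * R) * homSobolevHalf f := by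
  have hpi := Real.pi_pos
  have h1 := sq_lintegral_enorm_le hF hfc hR0.le hR
  have h2 := lintegral_enorm_sq_le hF hfc hf hf2 hR0 hR
  have h3 := h1.trans (mul_le_mul_right h2 _)
  rw [← mul_assoc, ← ENNReal.ofReal_mul (by positivity)] at h3
  have h4 := ENNReal.rpow_le_rpow h3 (by norm_num : (0:ℝ) ≤ 1 / 2)
  rw [sq_rpow_half, ENNReal.mul_rpow_of_nonneg _ _ (by norm_num : (0:ℝ) ≤ 1 / 2),
    ofReal_rpow_half (by positivity), homSobolevHalf_def] at h4
  refine h4.trans (le_of_eq ?_)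
  congr 2
  rw [show Real.pi * R ^ 2 * (2 * R) = (2 * Real.pi) * (R * R ^ 2) by ring,
    Real.sqrt_mul (by positivity), Real.sqrt_mul hR0.le, Real.sqrt_sq hR0.le, mul_assoc]

/-- Almost every `ω` is different from `± N`. -/
theorem ae_proj_ne_zero (N : S2) : ∀ᵐ ω : S2 ∂(volume : Measure E3).toSphere, proj N ω ≠ 0 := by
  obtain ⟨K, hK⟩ := exists_lintegral_inv_proj_le
  have hm : Measurable fun ω : S2 => ‖proj N ω‖ₑ⁻¹ := by fun_prop
  filter_upwards [ae_lt_top hm ((hK N).trans_lt ENNReal.coe_lt_top).ne] with ω hω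
  simpa using (ENNReal.inv_lt_top.1 hω).ne'

/-- Cauchy-Schwarz over the sphere, splitting `|ω'|^{1/2}` as `|ω'|^{-1/2} |ω'|`. -/
theorem lintegral_sphere_sqrt_le {K : ℝ≥0∞} {N : S2}
    (hK : ∫⁻ ω : S2, ‖proj N ω‖ₑ⁻¹ ∂(volume : Measure E3).toSphere ≤ K)
    {f : perp N → ℂ} (hf : Integrable f (lebesgue (perp N))) {J : S2 → ℝ≥0∞} (hJm : Measurable J)
    (hJ : ∀ ω, J ω = ∫⁻ τ in Set.Ioi (0:ℝ), ENNReal.ofReal (τ ^ 2) *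
          ‖𝓕 f (-(τ / (2 * Real.pi)) • proj N ω)‖ₑ ^ 2) :
    ∫⁻ ω : S2, ‖proj N ω‖ₑ ^ (1 / 2 : ℝ) * J ω ^ (1 / 2 : ℝ) ∂(volume : Measure E3).toSphere ≤
      K ^ (1 / 2 : ℝ) * (ENNReal.ofReal √(4 * Real.pi ^ 3) * homSobolevHalf f) := by
  have hρm : Measurable fun ω : S2 => ‖proj N ω‖ₑ := by fun_prop
  have h1 := lintegral_mul_le_sqrt (volume : Measure E3).toSphere
    (f := fun ω : S2 => ‖proj N ω‖ₑ⁻¹ ^ (1 / 2 : ℝ))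
    (g := fun ω : S2 => ‖proj N ω‖ₑ * J ω ^ (1 / 2 : ℝ)) (by fun_prop) (by fun_prop)
  simp only [mul_pow, rpow_half_sq] at h1
  simp only [hJ] at h1 ⊢
  rw [lintegral_sphere_fourier N hf, ENNReal.mul_rpow_of_nonneg _ _ (by norm_num : (0:ℝ) ≤ 1 / 2),
    ofReal_rpow_half (by have := Real.pi_pos; positivity), homSobolevHalf_def] at h1
  refine le_trans (le_of_eq (lintegral_congr_ae ?_))
    (h1.trans (mul_le_mul_left (ENNReal.rpow_le_rpow hK (by norm_num)) _))
  filter_upwards [ae_proj_ne_zero N] with ω hω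
  rw [← mul_assoc]
  congr 1
  have h0 : ‖proj N ω‖ₑ ≠ 0 := by simpa using hω
  have htop : ‖proj N ω‖ₑ ≠ ⊤ := enorm_ne_top
  generalize ‖proj N ω‖ₑ = a at h0 htop
  have h5 : a = a ^ (1 / 2 : ℝ) * a ^ (1 / 2 : ℝ) := by
    rw [← sq, rpow_half_sq]
  have h6 : a⁻¹ ^ (1 / 2 : ℝ) * a ^ (1 / 2 : ℝ) = 1 := by
    rw [← ENNReal.mul_rpow_of_nonneg _ _ (by norm_num), ENNReal.inv_mul_cancel h0 htop,
      ENNReal.one_rpow]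
  calc a ^ (1 / 2 : ℝ) = a⁻¹ ^ (1 / 2 : ℝ) * a ^ (1 / 2 : ℝ) * a ^ (1 / 2 : ℝ) := by
        rw [h6, one_mul]
    _ = _ := by rw [mul_assoc, ← h5]

/-- The estimate `∫∫ |L_ε f(ω', b(ω) + r / 2)| dr dω ≤ C R^{1/2} ‖f‖_{Ḣ^{1/2}}` for `f` supported
in a disc of radius `R`, with `C` independent of `ε`, of the plane and of the shifts `b`. -/
theorem exists_lintegral_regL_le : ∃ C : ℝ≥0, ∀ (N : S2) {ε R : ℝ} (_ : 0 < ε) (_ : 0 < R)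
    {f : perp N → ℂ} (_ : Continuous f) (_ : Integrable f (lebesgue (perp N)))
    (_ : MemLp f 2 (lebesgue (perp N))) (_ : ∀ x, R < ‖x‖ → f x = 0) (b : S2 → ℝ),
    ∫⁻ ω : S2, (∫⁻ r : ℝ, ‖regL ε f (proj N ω) (b ω + r / 2)‖ₑ) ∂(volume : Measure E3).toSphere ≤
      C * ENNReal.ofReal √R * homSobolevHalf f := by
  obtain ⟨K, hK⟩ := exists_lintegral_inv_proj_le
  refine ⟨(ENNReal.ofReal (√(32 * Real.pi) * √(4 * Real.pi ^ 3)) * (K : ℝ≥0∞) ^ (1 / 2 : ℝ) +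
    ENNReal.ofReal (8 * Real.pi * √(2 * Real.pi)) * K).toNNReal, ?_⟩
  intro N ε R hε hR0 f hfc hf hf2 hR b
  have hpi := Real.pi_pos
  rw [ENNReal.coe_toNNReal (by finiteness)]
  have hmeas : Measurable (𝓕 f) := (continuous_fourier hf).measurable
  obtain ⟨J, hJ⟩ : ∃ J : S2 → ℝ≥0∞, ∀ ω, J ω = ∫⁻ τ in Set.Ioi (0:ℝ), ENNReal.ofReal (τ ^ 2) *
          ‖𝓕 f (-(τ / (2 * Real.pi)) • proj N ω)‖ₑ ^ 2 := ⟨_, fun _ => rfl⟩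
  have hJm : Measurable J := by
    have : Measurable fun p : S2 × ℝ => ENNReal.ofReal (p.2 ^ 2) *
          ‖𝓕 f (-(p.2 / (2 * Real.pi)) • proj N p.1)‖ₑ ^ 2 := by fun_prop
    rw [funext hJ]
    exact this.lintegral_prod_right'
  have hAH := lintegral_enorm_le_homSobolevHalf (finrank_perp N) hfc hf hf2 hR0 hR
  have hJρ := lintegral_sphere_sqrt_le (hK N) hf hJm hJ
  have hρm : Measurable fun ω : S2 => ‖proj N ω‖ₑ := by fun_prop
  have hpt : ∀ᵐ ω : S2 ∂(volume : Measure E3).toSphere,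
      ∫⁻ r : ℝ, ‖regL ε f (proj N ω) (b ω + r / 2)‖ₑ ≤
        ENNReal.ofReal √(32 * Real.pi * R) * (‖proj N ω‖ₑ ^ (1 / 2 : ℝ) * J ω ^ (1 / 2 : ℝ)) +
        ENNReal.ofReal (8 * Real.pi / R) * (∫⁻ x, ‖f x‖ₑ ∂(lebesgue (perp N))) *
          ‖proj N ω‖ₑ⁻¹ := by
    filter_upwards [ae_proj_ne_zero N] with ω hω
    rw [lintegral_regL_add]
    refine (lintegral_regL_le hε hfc hf hR0 hR hω).trans (le_of_eq ?_)
    rw [← hJ]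
    congr 1
    · rw [ENNReal.mul_rpow_of_nonneg _ _ (by norm_num), ENNReal.mul_rpow_of_nonneg _ _ (by norm_num),
        ofReal_rpow_half (by positivity), ofReal_rpow_half (by positivity), mul_mul_mul_comm,
        ← ENNReal.ofReal_mul (by positivity), ← Real.sqrt_mul (by positivity)]
      congr 3
      ring
    · rw [mul_right_comm]
  generalize homSobolevHalf f = H at hAH hJρ ⊢
  generalize ∫⁻ x, ‖f x‖ₑ ∂(lebesgue (perp N)) = A at hAH hpt
  refine (lintegral_mono_ae hpt).trans ?_
  rw [lintegral_add_right _ (by fun_prop), lintegral_const_mul _ (by fun_prop),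
    lintegral_const_mul _ (by fun_prop), add_mul, add_mul]
  refine add_le_add ?_ ?_
  · refine (mul_le_mul_right hJρ _).trans (le_of_eq ?_)
    rw [Real.sqrt_mul (by positivity), ENNReal.ofReal_mul (by positivity),
      ENNReal.ofReal_mul (by positivity)]
    ring
  · refine (mul_le_mul' (mul_le_mul_right hAH _) (hK N)).trans (le_of_eq ?_)
    have h : ENNReal.ofReal (8 * Real.pi / R) * ENNReal.ofReal (√(2 * Real.pi) * √R * R) =
        ENNReal.ofReal (8 * Real.pi * √(2 * Real.pi)) * ENNReal.ofReal √R := by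
      rw [← ENNReal.ofReal_mul (by positivity), ← ENNReal.ofReal_mul (by positivity)]
      congr 1
      field_simp
    rw [← mul_assoc, h]
    ring

/-! ### Littlewood-Paley pieces of a Schwartz function -/

/-- The exponent `6` leaves room for `(1 + 2^k)^{-4}` and `(1 + s²)⁻¹` in the bounds of the
pieces. -/
theorem exists_schwartz_decay (v : 𝓢(E3, ℂ)) : ∃ C : ℝ, 0 ≤ C ∧ ∀ x,
    ‖v x‖ ≤ C * ((1 + ‖x‖) ^ 6)⁻¹ ∧ ‖fderiv ℝ v x‖ ≤ C * ((1 + ‖x‖) ^ 6)⁻¹ := by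
  set C := 2 ^ 6 * (Finset.Iic ((6, 1) : ℕ × ℕ)).sup (fun m => SchwartzMap.seminorm ℝ m.1 m.2) v
    with hC
  have h0 : ∀ x, (1 + ‖x‖) ^ 6 * ‖v x‖ ≤ C := fun x => by
    have := SchwartzMap.one_add_le_sup_seminorm_apply (𝕜 := ℝ) (m := (6, 1)) (k := 6) (n := 0)
      le_rfl zero_le_one v x
    simpa using this
  have h1 : ∀ x, (1 + ‖x‖) ^ 6 * ‖fderiv ℝ v x‖ ≤ C := fun x => by
    have := SchwartzMap.one_add_le_sup_seminorm_apply (𝕜 := ℝ) (m := (6, 1)) (k := 6) (n := 1)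
      le_rfl le_rfl v x
    rwa [norm_iteratedFDeriv_one] at this
  refine ⟨C, le_trans (by positivity) (h0 0), fun x => ⟨?_, ?_⟩⟩
  · rw [← div_eq_mul_inv, le_div_iff₀ (by positivity), mul_comm]
    exact h0 x
  · rw [← div_eq_mul_inv, le_div_iff₀ (by positivity), mul_comm]
    exact h1 x

theorem IsLittlewoodPaley.exists_bounds {ψ : E3 → ℝ} (hψ : IsLittlewoodPaley ψ) :
    ∃ a A M : ℝ, 0 < a ∧ 0 < A ∧ 0 ≤ M ∧ (∀ x ∈ tsupport ψ, a ≤ ‖x‖ ∧ ‖x‖ ≤ A) ∧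
      (∀ x, |ψ x| ≤ M) ∧ ∀ x, ‖fderiv ℝ ψ x‖ ≤ M := by
  obtain ⟨a, ha, hball⟩ := Metric.isOpen_iff.1 (isClosed_tsupport ψ).isOpen_compl 0
    hψ.zero_notMem
  obtain ⟨A, hA⟩ := hψ.hasCompactSupport.isCompact.isBounded.exists_norm_le
  obtain ⟨M₁, hM₁⟩ := hψ.hasCompactSupport.exists_bound_of_continuous hψ.smooth.continuous
  obtain ⟨M₂, hM₂⟩ := (hψ.hasCompactSupport.fderiv (𝕜 := ℝ)).exists_bound_of_continuous
    (hψ.smooth.continuous_fderiv (by norm_num))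
  refine ⟨a, max A 1, max (max M₁ M₂) 0, ha, by positivity, by positivity, fun x hx => ⟨?_, ?_⟩,
    fun x => ?_, fun x => ?_⟩
  · by_contra! h
    exact hball (by simpa using h) hx
  · exact (hA x hx).trans (le_max_left _ _)
  · exact (hM₁ x).trans ((le_max_left _ _).trans (le_max_left _ _))
  · exact (hM₂ x).trans ((le_max_right _ _).trans (le_max_left _ _))

theorem IsLittlewoodPaley.contDiff_piece {ψ : E3 → ℝ} (hψ : IsLittlewoodPaley ψ)
    (v : 𝓢(E3, ℂ)) (ω : S2) (s : ℝ) (k : ℤ) :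
    ContDiff ℝ (⊤ : ℕ∞) (piece ψ v ω s k) := by
  unfold piece
  have h1 := hψ.smooth
  have h2 : ContDiff ℝ (⊤ : ℕ∞) v := v.smooth _
  have h3 : ContDiff ℝ (⊤ : ℕ∞) fun x' : perp ω => (x' : E3) := (perp ω).subtypeL.contDiff
  have h4 : ContDiff ℝ (⊤ : ℕ∞) fun x' : perp ω => ψ ((2 : ℝ) ^ (-k) • (x' : E3)) :=
    h1.comp (h3.const_smul _)
  have h5 : ContDiff ℝ (⊤ : ℕ∞) fun x' : perp ω => v ((x' : E3) + s • (ω : E3)) :=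
    h2.comp (h3.add contDiff_const)
  exact (Complex.ofRealCLM.contDiff.comp h4).mul h5

theorem piece_eq_zero {ψ : E3 → ℝ} (v : 𝓢(E3, ℂ)) (ω : S2) (s : ℝ) (k : ℤ)
    {A : ℝ} (hA : ∀ x ∈ tsupport ψ, ‖x‖ ≤ A) {x' : perp ω}
    (hx : A * 2 ^ k < ‖x'‖) : piece ψ v ω s k x' = 0 := by
  have h : ψ ((2 : ℝ) ^ (-k) • (x' : E3)) = 0 := by
    apply image_eq_zero_of_notMem_tsupport
    intro hmem
    have h1 := hA _ hmem
    rw [norm_smul, Real.norm_of_nonneg (by positivity), zpow_neg, inv_mul_le_iff₀ (by positivity),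
      mul_comm] at h1
    exact h1.not_gt hx
  rw [piece, h, Complex.ofReal_zero, zero_mul]

theorem IsLittlewoodPaley.hasCompactSupport_piece {ψ : E3 → ℝ} (hψ : IsLittlewoodPaley ψ)
    (v : 𝓢(E3, ℂ)) (ω : S2) (s : ℝ) (k : ℤ) :
    HasCompactSupport (piece ψ v ω s k) := by
  obtain ⟨a, A, M, ha, hA, hM, hsupp, -, -⟩ := hψ.exists_bounds
  refine HasCompactSupport.of_support_subset_isCompact
    (isCompact_closedBall (0 : perp ω) (A * 2 ^ k)) fun x hx => ?_
  rw [mem_closedBall_zero_iff]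
  by_contra! h
  exact hx (piece_eq_zero v ω s k (fun x hx => (hsupp x hx).2) h)

theorem IsLittlewoodPaley.integrable_piece {ψ : E3 → ℝ} (hψ : IsLittlewoodPaley ψ)
    (v : 𝓢(E3, ℂ)) (ω : S2) (s : ℝ) (k : ℤ) :
    Integrable (piece ψ v ω s k) (lebesgue (perp ω)) :=
  (hψ.contDiff_piece v ω s k).continuous.integrable_of_hasCompactSupport
    (hψ.hasCompactSupport_piece v ω s k)

theorem IsLittlewoodPaley.memLp_piece {ψ : E3 → ℝ} (hψ : IsLittlewoodPaley ψ)
    (v : 𝓢(E3, ℂ)) (ω : S2) (s : ℝ) (k : ℤ) :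
    MemLp (piece ψ v ω s k) 2 (lebesgue (perp ω)) :=
  (hψ.contDiff_piece v ω s k).continuous.memLp_of_hasCompactSupport
    (hψ.hasCompactSupport_piece v ω s k)

/-- On the support of the `k`-th piece `|x'| ≳ 2^k`, so that the decay of `v` splits into decay in
`2^k` and decay in `s`. -/
theorem inv_one_add_norm_pow_le (ω : S2) (s : ℝ) (k : ℤ)
    {c : ℝ} (hc0 : 0 < c) (hc1 : c ≤ 1) (x' : perp ω)
    (hx : c * 2 ^ k ≤ ‖x'‖) :
    ((1 + ‖(x' : E3) + s • (ω : E3)‖) ^ 6)⁻¹ ≤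
      (c ^ 4)⁻¹ * ((1 + (2 : ℝ) ^ k) ^ 4)⁻¹ * (1 + s ^ 2)⁻¹ := by
  have h := norm_sq_add_smul ω x' s
  set y := ‖(x' : E3) + s • (ω : E3)‖ with hy
  have hy0 : 0 ≤ y := norm_nonneg _
  have h1 : ‖x'‖ ≤ y := by nlinarith [norm_nonneg x', sq_nonneg s]
  have h2 : s ^ 2 ≤ y ^ 2 := by nlinarith [sq_nonneg ‖x'‖]
  have h3 : c * (1 + (2 : ℝ) ^ k) ≤ 1 + y := by linarith
  have h4 : 1 + s ^ 2 ≤ (1 + y) ^ 2 := by nlinarith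
  rw [← mul_inv, ← mul_inv]
  apply inv_anti₀ (by positivity)
  calc c ^ 4 * (1 + (2 : ℝ) ^ k) ^ 4 * (1 + s ^ 2) = (c * (1 + (2 : ℝ) ^ k)) ^ 4 * (1 + s ^ 2) := by
        ring
    _ ≤ (1 + y) ^ 4 * (1 + y) ^ 2 := by gcongr
    _ = (1 + y) ^ 6 := by ring

theorem IsLittlewoodPaley.exists_piece_bounds {ψ : E3 → ℝ} (hψ : IsLittlewoodPaley ψ)
    (v : 𝓢(E3, ℂ)) : ∃ A B : ℝ, 0 < A ∧ 0 ≤ B ∧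
    ∀ (ω : S2) (s : ℝ) (k : ℤ) (x' : perp ω),
      (A * 2 ^ k < ‖x'‖ → piece ψ v ω s k x' = 0 ∧ fderiv ℝ (piece ψ v ω s k) x' = 0) ∧
      ‖piece ψ v ω s k x'‖ ≤ B * ((1 + (2 : ℝ) ^ k) ^ 4)⁻¹ * (1 + s ^ 2)⁻¹ ∧
      ‖fderiv ℝ (piece ψ v ω s k) x'‖ ≤
        B * ((1 + (2 : ℝ) ^ k) ^ 4)⁻¹ * (1 + s ^ 2)⁻¹ * (1 + ((2 : ℝ) ^ k)⁻¹) := by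
  obtain ⟨a, A, M, ha, hA, hM, hsupp, hψM, hψM'⟩ := hψ.exists_bounds
  obtain ⟨C, hC, hv⟩ := exists_schwartz_decay v
  set c := min a 1 with hc
  have hc0 : 0 < c := by positivity
  have hc1 : c ≤ 1 := min_le_right _ _
  refine ⟨A, M * C * (c ^ 4)⁻¹, hA, by positivity, fun ω s k x' => ⟨fun hx => ?_, ?_⟩⟩
  · refine ⟨piece_eq_zero v ω s k (fun x hx => (hsupp x hx).2) hx, ?_⟩
    have : piece ψ v ω s k =ᶠ[nhds x'] fun _ => 0 := by
      filter_upwards [(isOpen_lt continuous_const continuous_norm).mem_nhds hx] with y hy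
      exact piece_eq_zero v ω s k (fun x hx => (hsupp x hx).2) hy
    rw [this.fderiv_eq]
    simp
  · set κ : ℝ := 2 ^ k with hκ
    have hκ0 : 0 < κ := by positivity
    have hzp : (2 : ℝ) ^ (-k) = κ⁻¹ := zpow_neg _ _
    -- off the preimage of `tsupport ψ` the piece vanishes in a neighbourhood of `x'`
    by_cases hx : κ⁻¹ • (x' : E3) ∈ tsupport ψ
    · have hxa : c * κ ≤ ‖x'‖ := by
        have h1 := (hsupp _ hx).1
        rw [norm_smul, Real.norm_of_nonneg (by positivity), le_inv_mul_iff₀ hκ0] at h1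
        calc c * κ ≤ a * κ := by gcongr; exact min_le_left _ _
          _ ≤ _ := by rw [mul_comm]; exact h1
      have hdec := inv_one_add_norm_pow_le ω s k hc0 hc1 x' hxa
      have hv0 := (hv ((x' : E3) + s • (ω : E3))).1.trans (mul_le_mul_of_nonneg_left hdec hC)
      have hv1 := (hv ((x' : E3) + s • (ω : E3))).2.trans (mul_le_mul_of_nonneg_left hdec hC)
      set D : ℝ := C * ((c ^ 4)⁻¹ * ((1 + (2 : ℝ) ^ k) ^ 4)⁻¹ * (1 + s ^ 2)⁻¹) with hD
      have hD0 : 0 ≤ D := by positivity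
      have hMD : M * C * (c ^ 4)⁻¹ * ((1 + κ) ^ 4)⁻¹ * (1 + s ^ 2)⁻¹ = M * D := by
        rw [hD]; ring
      rw [hMD]
      constructor
      · rw [piece, norm_mul, Complex.norm_real]
        exact mul_le_mul (hψM _) hv0 (norm_nonneg _) hM
      · have hι : HasFDerivAt (fun x' : perp ω => (x' : E3)) (perp ω).subtypeL x' :=
          (perp ω).subtypeL.hasFDerivAt
        have hd1 : HasFDerivAt (fun x' : perp ω => ((ψ ((2 : ℝ) ^ (-k) • (x' : E3)) : ℝ) : ℂ))
            (Complex.ofRealCLM.comp ((fderiv ℝ ψ ((2 : ℝ) ^ (-k) • (x' : E3))).comp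
              ((2 : ℝ) ^ (-k) • (perp ω).subtypeL))) x' :=
          Complex.ofRealCLM.hasFDerivAt.comp x'
            (((hψ.smooth.differentiable (by norm_num)) _).hasFDerivAt.comp x' (hι.fun_const_smul _))
        have hd2 : HasFDerivAt (fun x' : perp ω => v ((x' : E3) + s • (ω : E3)))
            ((fderiv ℝ v ((x' : E3) + s • (ω : E3))).comp (perp ω).subtypeL) x' :=
          (v.differentiableAt.hasFDerivAt).comp x' (hι.add_const _)
        have hd := hd1.mul hd2
        rw [show fderiv ℝ (piece ψ v ω s k) x' = _ from hd.fderiv]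
        have hιn : ‖(perp ω).subtypeL‖ ≤ 1 := (perp ω).norm_subtypeL_le
        have hofR : ‖Complex.ofRealCLM‖ ≤ 1 := Complex.ofRealCLM_norm.le
        refine (ContinuousLinearMap.opNorm_add_le _ _).trans ?_
        rw [norm_smul, norm_smul, Complex.norm_real]
        have hn2 : ‖(fderiv ℝ v ((x' : E3) + s • (ω : E3))).comp (perp ω).subtypeL‖ ≤ D * 1 :=
          (ContinuousLinearMap.opNorm_comp_le _ _).trans (by gcongr)
        have hn1 : ‖Complex.ofRealCLM.comp ((fderiv ℝ ψ ((2 : ℝ) ^ (-k) • (x' : E3))).comp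
              ((2 : ℝ) ^ (-k) • (perp ω).subtypeL))‖ ≤ 1 * (M * (κ⁻¹ * 1)) := by
          refine (ContinuousLinearMap.opNorm_comp_le _ _).trans ?_
          gcongr
          refine (ContinuousLinearMap.opNorm_comp_le _ _).trans ?_
          gcongr
          · exact hψM' _
          · rw [norm_smul, Real.norm_of_nonneg (by positivity), hzp]
            gcongr
        calc _ ≤ M * (D * 1) + D * (1 * (M * (κ⁻¹ * 1))) := by
              gcongr
              exact hψM _
          _ = M * D * (1 + κ⁻¹) := by ring
    · have hz : piece ψ v ω s k =ᶠ[nhds x'] fun _ => 0 := by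
        have hcont : Continuous fun y : perp ω => κ⁻¹ • (y : E3) := by fun_prop
        filter_upwards [hcont.continuousAt.preimage_mem_nhds
          ((isClosed_tsupport ψ).isOpen_compl.mem_nhds hx)] with y hy
        have : ψ (κ⁻¹ • (y : E3)) = 0 := image_eq_zero_of_notMem_tsupport hy
        simp [piece, hzp, this]
      have h0 : ‖fderiv ℝ (piece ψ v ω s k) x'‖ = 0 := by
        rw [hz.fderiv_eq, fderiv_fun_const]
        exact norm_zero (E := perp ω →L[ℝ] ℂ)
      rw [h0, hz.eq_of_nhds, norm_zero]
      constructor <;> positivity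

theorem two_zpow_mul_inv_le (k : ℤ) :
    (2 : ℝ) ^ k * ((1 + (2 : ℝ) ^ k) ^ 2)⁻¹ ≤ (1 / 2) ^ k.natAbs := by
  have hk : (0 : ℝ) < 2 ^ k := by positivity
  rw [← div_eq_mul_inv, div_le_iff₀ (by positivity)]
  obtain ⟨n, rfl | rfl⟩ := Int.eq_nat_or_neg k
  · rw [Int.natAbs_natCast, zpow_natCast, one_div, inv_pow]
    have h2 : (0 : ℝ) < 2 ^ n := by positivity
    rw [le_inv_mul_iff₀ h2]
    nlinarith
  · rw [Int.natAbs_neg, Int.natAbs_natCast, zpow_neg, zpow_natCast, one_div, inv_pow]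
    have h2 : (0 : ℝ) < (2 ^ n)⁻¹ := by positivity
    nlinarith [mul_pos h2 h2, mul_pos h2 (mul_pos h2 h2)]

theorem summable_half_pow_natAbs : Summable fun k : ℤ => (1 / 2 : ℝ) ^ k.natAbs := by
  have h := summable_geometric_of_lt_one (r := (1 / 2 : ℝ)) (by norm_num) (by norm_num)
  refine Summable.of_nat_of_neg ?_ ?_ <;> simpa using h

/-! ### Comparison of the two norms -/

/-- The restriction of a Schwartz function to the affine plane `N^⊥ + t N`, as a Schwartz function
on `N^⊥`. -/
noncomputable def slice (v : 𝓢(E3, ℂ)) (N : S2) (t : ℝ) : 𝓢(perp N, ℂ) :=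
  SchwartzMap.compCLMOfAntilipschitz ℂ (K := 1) (g := fun x' : perp N => (x' : E3) + t • (N : E3))
    ((perp N).subtypeL.hasTemperateGrowth.add (.const _))
    (AntilipschitzWith.of_le_mul_dist fun x y => by simp [Subtype.dist_eq]) v

theorem slice_apply (v : 𝓢(E3, ℂ)) (N : S2) (t : ℝ) (x' : perp N) :
    slice v N t x' = v (x' + t • (N : E3)) := rfl

theorem fourierMeas_planeMeasure (N : S2) (t : ℝ) (v : E3 → ℂ) (ξ : E3) :
    fourierMeas (planeMeasure N t) v ξ = ∫ x' : perp N,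
      Complex.exp (-Complex.I * (⟪(x' : E3) + t • (N : E3), ξ⟫ : ℝ)) * v (x' + t • (N : E3))
        ∂(lebesgue (perp N)) := by
  have h : MeasurableEmbedding fun x' : perp N => (x' : E3) + t • (N : E3) :=
    (measurableEmbedding_addRight (t • (N : E3))).comp
      (MeasurableEmbedding.subtype_coe (Submodule.closed_of_finiteDimensional _).measurableSet)
  rw [fourierMeas, planeMeasure, h.integral_map]

/-- The Fourier transform of `δ v` on the plane `N^⊥ + t N`, along a ray, in terms of the Fourier
transform of the slice along the projected ray. -/
theorem fourierMeas_planeMeasure_neg_smul (N : S2) (t : ℝ) (v : 𝓢(E3, ℂ)) (τ : ℝ) (ω : S2) :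
    fourierMeas (planeMeasure N t) v (-(τ • (ω : E3))) =
      Complex.exp (Complex.I * (t * ⟪(N : E3), (ω : E3)⟫ : ℝ) * τ) *
        𝓕 (slice v N t : perp N → ℂ) (-(τ / (2 * Real.pi)) • proj N ω) := by
  rw [fourierMeas_planeMeasure, fourier_neg_smul, ← integral_const_mul]
  refine integral_congr_ae (.of_forall fun x' => ?_)
  simp only [slice_apply]
  rw [← mul_assoc, ← Complex.exp_add, inner_neg_right, inner_smul_right, inner_add_left,
    real_inner_smul_left, inner_eq_inner_proj]
  congr 2
  push_cast
  ring

theorem LTransform_planeMeasure (N : S2) (t : ℝ) (v : 𝓢(E3, ℂ)) (r : ℝ) (ω : S2) :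
    LTransform (planeMeasure N t) v r ω = ∫ τ in Set.Ioi (0:ℝ), (τ : ℂ) *
      𝓕 (slice v N t : perp N → ℂ) (-(τ / (2 * Real.pi)) • proj N ω) *
        Complex.exp (Complex.I * (t * ⟪(N : E3), (ω : E3)⟫ + r / 2 : ℝ) * τ) := by
  unfold LTransform
  congr 1
  ext τ
  rw [fourierMeas_planeMeasure_neg_smul]
  have : Complex.exp (Complex.I * (t * ⟪(N : E3), (ω : E3)⟫ + r / 2 : ℝ) * τ) =
      Complex.exp (Complex.I * (t * ⟪(N : E3), (ω : E3)⟫ : ℝ) * τ) *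
        Complex.exp (Complex.I / 2 * r * τ) := by
    rw [← Complex.exp_add]
    push_cast
    ring_nf
  rw [this]
  ring

theorem integrable_mul_schwartz_ray {F : Type*} [NormedAddCommGroup F] [InnerProductSpace ℝ F]
    [FiniteDimensional ℝ F] [MeasurableSpace F] [BorelSpace F] (w : 𝓢(F, ℂ)) {y : F} (hy : y ≠ 0) :
    Integrable fun τ : ℝ => ‖τ‖ * ‖w (-(τ / (2 * Real.pi)) • y)‖ := by
  have hpi := Real.pi_pos
  have hy' : 0 < ‖y‖ := norm_pos_iff.2 hy
  let c : F := (-(1 / (2 * Real.pi))) • y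
  have hc : c ≠ 0 := smul_ne_zero (by simp [hpi.ne']) hy
  let g : ℝ →L[ℝ] F := ContinuousLinearMap.toSpanSingleton ℝ c
  have hg : AntilipschitzWith ‖c‖₊⁻¹ g := by
    refine AntilipschitzWith.of_le_mul_dist fun a b => ?_
    have : 0 < ‖c‖ := norm_pos_iff.2 hc
    rw [dist_eq_norm, dist_eq_norm, ← map_sub, ContinuousLinearMap.toSpanSingleton_apply, norm_smul]
    simp only [NNReal.coe_inv, coe_nnnorm]
    rw [mul_comm ‖a - b‖, inv_mul_cancel_left₀ this.ne']
  let u : 𝓢(ℝ, ℂ) := SchwartzMap.compCLMOfAntilipschitz ℂ g.hasTemperateGrowth hg w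
  have := u.integrable_pow_mul volume 1
  refine this.congr (.of_forall fun τ => ?_)
  have h : (-(τ / (2 * Real.pi)) • y) = g τ := by
    simp only [g, ContinuousLinearMap.toSpanSingleton_apply, c, smul_smul]
    congr 1
    ring
  simp only [pow_one, h]
  rfl

/-- Away from `ω = ± N`, the regularised transforms of a slice converge to the transform of the
measure on the plane, by dominated convergence along the ray. -/
theorem tendsto_regL {N : S2} {t : ℝ} (v : 𝓢(E3, ℂ)) (r : ℝ) {ω : S2} (hω : proj N ω ≠ 0) :
    Filter.Tendsto (fun n : ℕ => regL (1 / ((n : ℝ) + 1)) (slice v N t) (proj N ω)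
      (t * ⟪(N : E3), (ω : E3)⟫ + r / 2)) Filter.atTop
      (nhds (LTransform (planeMeasure N t) v r ω)) := by
  rw [LTransform_planeMeasure]
  have hε : ∀ n : ℕ, 0 < 1 / ((n : ℝ) + 1) := fun n => Nat.one_div_pos_of_nat
  have hint : Integrable (slice v N t) (lebesgue (perp N)) := (slice v N t).integrable
  simp_rw [fun n => regL_eq (hε n) hint]
  have hcont := continuous_fourier hint
  have hb := (integrable_mul_schwartz_ray (𝓕 (slice v N t)) hω).integrableOn (s := Set.Ioi 0)
  refine tendsto_integral_of_dominated_convergence _ (fun n => ?_) hb (fun n => ?_) ?_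
  · exact Continuous.aestronglyMeasurable (by fun_prop)
  · filter_upwards [ae_restrict_mem measurableSet_Ioi] with τ hτ
    have hτ : 0 < τ := hτ
    have h1 : Real.exp (-(1 / ((n : ℝ) + 1)) * τ) ≤ 1 :=
      Real.exp_le_one_iff.2 (by nlinarith [hε n])
    have h2 : ‖Complex.exp (Complex.I * (t * ⟪(N : E3), (ω : E3)⟫ + r / 2 : ℝ) * τ)‖ = 1 := by
      rw [Complex.norm_exp]; simp
    rw [norm_mul, norm_mul, h2, mul_one, Complex.norm_real, norm_mul,
      Real.norm_of_nonneg (Real.exp_pos _).le]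
    rw [SchwartzMap.fourier_coe]
    gcongr
    exact mul_le_of_le_one_right (norm_nonneg _) h1
  · refine .of_forall fun τ => ?_
    refine (Filter.Tendsto.mul_const _ ?_).mul_const _
    have h1 : Filter.Tendsto (fun n : ℕ => τ * Real.exp (-(1 / ((n : ℝ) + 1)) * τ)) Filter.atTop
        (nhds (τ * Real.exp (-0 * τ))) := by
      refine Filter.Tendsto.const_mul _ (Real.continuous_exp.continuousAt.tendsto.comp ?_)
      exact (tendsto_one_div_add_atTop_nhds_zero_nat.neg).mul_const _
    rw [neg_zero, zero_mul, Real.exp_zero, mul_one] at h1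
    exact (Complex.continuous_ofReal.tendsto _).comp h1

theorem tsum_lintegral_piece_lt_top {ψ : E3 → ℝ} (hψ : IsLittlewoodPaley ψ) (v : 𝓢(E3, ℂ))
    (N : S2) (t : ℝ) :
    ∑' k, ∫⁻ x, ‖piece ψ v N t k x‖ₑ ∂(lebesgue (perp N)) < ⊤ := by
  obtain ⟨A, B, hA, hB, h⟩ := hψ.exists_piece_bounds v
  have hle : ∀ k : ℤ, ∫⁻ x, ‖piece ψ v N t k x‖ₑ ∂(lebesgue (perp N)) ≤
      ENNReal.ofReal (B * Real.pi * A ^ 2 * (1 / 2) ^ k.natAbs) := by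
    intro k
    have hpos : (0:ℝ) < 2 ^ k := by positivity
    have h1 : ∀ x, ‖piece ψ v N t k x‖ₑ ≤ (Metric.closedBall (0 : perp N) (A * 2 ^ k)).indicator
        (fun _ => ENNReal.ofReal (B * ((1 + (2 : ℝ) ^ k) ^ 4)⁻¹)) x := by
      intro x
      by_cases hx : x ∈ Metric.closedBall (0 : perp N) (A * 2 ^ k)
      · rw [Set.indicator_of_mem hx, ← ofReal_norm]
        apply ENNReal.ofReal_le_ofReal
        refine (h N t k x).2.1.trans (mul_le_of_le_one_right (by positivity) ?_)
        exact inv_le_one_of_one_le₀ (by nlinarith [sq_nonneg t])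
      · rw [Set.indicator_of_notMem hx, ((h N t k x).1 (by simpa using hx)).1]
        simp
    refine (lintegral_mono h1).trans ?_
    rw [lintegral_indicator Metric.isClosed_closedBall.measurableSet, setLIntegral_const,
      lebesgue_closedBall (finrank_perp N) (by positivity), ← ENNReal.ofReal_mul (by positivity)]
    apply ENNReal.ofReal_le_ofReal
    have h2 := two_zpow_mul_inv_le k
    have h3 : (1 / 2 : ℝ) ^ k.natAbs ≤ 1 := pow_le_one₀ (by norm_num) (by norm_num)
    set q : ℝ := 2 ^ k * ((1 + (2 : ℝ) ^ k) ^ 2)⁻¹ with hq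
    have hq0 : 0 ≤ q := by positivity
    calc B * ((1 + (2 : ℝ) ^ k) ^ 4)⁻¹ * (Real.pi * (A * 2 ^ k) ^ 2)
        = B * Real.pi * A ^ 2 * (q * q) := by rw [hq]; field_simp
      _ ≤ B * Real.pi * A ^ 2 * ((1 / 2) ^ k.natAbs * 1) := by
          have := Real.pi_pos
          gcongr
          exact h2.trans h3
      _ = _ := by rw [mul_one]
  refine (ENNReal.tsum_le_tsum hle).trans_lt ?_
  rw [← ENNReal.ofReal_tsum_of_nonneg (fun k => by have := Real.pi_pos; positivity)
    (summable_half_pow_natAbs.mul_left _)]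
  exact ENNReal.ofReal_lt_top

theorem hasSum_piece {ψ : E3 → ℝ} (hψ : IsLittlewoodPaley ψ) (v : 𝓢(E3, ℂ))
    (N : S2) (t : ℝ) {x : perp N} (hx : x ≠ 0) :
    HasSum (fun k => piece ψ v N t k x) (slice v N t x) := by
  have h := (hψ.hasSum x (by simpa using hx))
  have h2 := (Complex.hasSum_ofReal.2 h).mul_right (v (x + t • (N : E3)))
  simpa [piece, slice_apply] using h2

/-- The regularised kernel is bounded for fixed `ε`, so the regularised transform of the slice is
the absolutely convergent sum of those of its Littlewood-Paley pieces. -/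
theorem enorm_regL_slice_le {ψ : E3 → ℝ} (hψ : IsLittlewoodPaley ψ) (v : 𝓢(E3, ℂ))
    (N : S2) (t : ℝ) {ε : ℝ} (hε : 0 < ε) (y : perp N) (a : ℝ) :
    ‖regL ε (slice v N t) y a‖ₑ ≤ ∑' k, ‖regL ε (piece ψ v N t k) y a‖ₑ := by
  set κ : perp N → ℂ := fun x => 1 / ((ε : ℂ) - Complex.I * (⟪x, y⟫ + a : ℝ)) ^ 2 with hκ
  have hκb : ∀ x, ‖κ x‖ₑ ≤ ENNReal.ofReal (1 / ε ^ 2) := by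
    intro x
    rw [← ofReal_norm]
    apply ENNReal.ofReal_le_ofReal
    have h1 : ε ≤ ‖(ε : ℂ) - Complex.I * (⟪x, y⟫ + a : ℝ)‖ := by
      have := Complex.re_le_norm ((ε : ℂ) - Complex.I * (⟪x, y⟫ + a : ℝ))
      have him : ((ε : ℂ) - Complex.I * (⟪x, y⟫ + a : ℝ)).re = ε := by
        rw [Complex.sub_re, Complex.ofReal_re, Complex.I_mul_re, Complex.ofReal_im, neg_zero,
          sub_zero]
      rwa [him] at this
    rw [hκ, norm_div, norm_one, norm_pow]
    gcongr
  have hκm : Measurable κ := by fun_prop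
  have h1 : regL ε (slice v N t) y a =
      ∫ x, ∑' k, piece ψ v N t k x * κ x ∂(lebesgue (perp N)) := by
    refine integral_congr_ae ?_
    have : Nontrivial (perp N) := Module.nontrivial_of_finrank_pos (R := ℝ)
      (by rw [finrank_perp]; norm_num)
    have h0 : ∀ᵐ x ∂(lebesgue (perp N)), x ≠ 0 := by
      rw [ae_iff]; simp
    filter_upwards [h0] with x hx
    exact ((hasSum_piece hψ v N t hx).mul_right _).tsum_eq.symm
  rw [h1, integral_tsum]
  · exact enorm_tsum_le_tsum_enorm
  · intro k
    exact ((hψ.contDiff_piece v N t k).continuous.measurable.mul hκm).aestronglyMeasurable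
  · refine ne_of_lt (lt_of_le_of_lt (ENNReal.tsum_le_tsum (g := fun k =>
      (∫⁻ x, ‖piece ψ v N t k x‖ₑ ∂(lebesgue (perp N))) * ENNReal.ofReal (1 / ε ^ 2))
      fun k => ?_) ?_)
    · rw [← lintegral_mul_const' _ _ ENNReal.ofReal_ne_top]
      refine lintegral_mono fun x => ?_
      rw [enorm_mul]
      gcongr
      exact hκb x
    · rw [ENNReal.tsum_mul_right]
      exact ENNReal.mul_lt_top (tsum_lintegral_piece_lt_top hψ v N t) ENNReal.ofReal_lt_top

/-- Each plane contributes to `normB` at most a multiple of what it contributes to `normBStar`. -/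
theorem exists_tripleNorm_le {ψ : E3 → ℝ} (hψ : IsLittlewoodPaley ψ) : ∃ C : ℝ≥0,
    ∀ (v : 𝓢(E3, ℂ)) (N : S2) (t : ℝ), tripleNorm (planeMeasure N t) v ≤
      C * ∑' k : ℤ, ENNReal.ofReal ((2 : ℝ) ^ ((k : ℝ) / 2)) *
        homSobolevHalf (piece ψ v N t k) := by
  obtain ⟨a, A, M, -, hA, -, hsupp, -, -⟩ := hψ.exists_bounds
  obtain ⟨C, hC⟩ := exists_lintegral_regL_le
  refine ⟨C * Real.toNNReal √A, fun v N t => ?_⟩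
  set b : S2 → ℝ := fun ω => t * ⟪(N : E3), (ω : E3)⟫ with hb
  have hm : ∀ (ε : ℝ) {f : perp N → ℂ} (hf : Continuous f), Measurable fun p : ℝ × S2 =>
      ‖regL ε f (proj N p.2) (b p.2 + p.1 / 2)‖ₑ := by
    intro ε f hf
    have : Measurable fun p : ℝ × S2 => (proj N p.2, b p.2 + p.1 / 2) := by fun_prop
    exact ((measurable_regL ε hf).comp this).enorm
  set μ := (volume : Measure ℝ).prod (volume : Measure E3).toSphere with hμ
  set S := (C * Real.toNNReal √A : ℝ≥0) * ∑' k : ℤ, ENNReal.ofReal ((2 : ℝ) ^ ((k : ℝ) / 2)) *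
        homSobolevHalf (piece ψ v N t k) with hS
  have hreg : ∀ ε : ℝ, 0 < ε →
      ∫⁻ p : ℝ × S2, ‖regL ε (slice v N t) (proj N p.2) (b p.2 + p.1 / 2)‖ₑ ∂μ ≤ S := by
    intro ε hε
    calc _ ≤ ∫⁻ p : ℝ × S2, ∑' k, ‖regL ε (piece ψ v N t k) (proj N p.2) (b p.2 + p.1 / 2)‖ₑ ∂μ :=
          lintegral_mono fun p => enorm_regL_slice_le hψ v N t hε _ _
      _ = ∑' k, ∫⁻ p : ℝ × S2, ‖regL ε (piece ψ v N t k) (proj N p.2) (b p.2 + p.1 / 2)‖ₑ ∂μ :=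
          lintegral_tsum fun k => (hm ε (hψ.contDiff_piece v N t k).continuous).aemeasurable
      _ ≤ ∑' k, C * ENNReal.ofReal √(A * 2 ^ k) * homSobolevHalf (piece ψ v N t k) := by
          refine ENNReal.tsum_le_tsum fun k => ?_
          have hc := (hψ.contDiff_piece v N t k).continuous
          rw [hμ, lintegral_prod_symm _ (hm ε hc).aemeasurable]
          exact hC N hε (by positivity) hc (hψ.integrable_piece v N t k) (hψ.memLp_piece v N t k)
            (fun x hx => piece_eq_zero v N t k (fun x hx => (hsupp x hx).2) hx) b
      _ = S := by
          rw [hS, ← ENNReal.tsum_mul_left]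
          refine tsum_congr fun k => ?_
          have h2 : √((2 : ℝ) ^ k) = (2 : ℝ) ^ ((k : ℝ) / 2) := by
            rw [Real.sqrt_eq_rpow, ← Real.rpow_intCast, ← Real.rpow_mul (by norm_num)]
            congr 1
            ring
          rw [Real.sqrt_mul hA.le, ENNReal.ofReal_mul (Real.sqrt_nonneg _), h2, ENNReal.coe_mul,
            ENNReal.ofReal, ENNReal.ofReal]
          ring
  have hae : ∀ᵐ p : ℝ × S2 ∂μ, proj N p.2 ≠ 0 :=
    Measure.quasiMeasurePreserving_snd.ae (ae_proj_ne_zero N)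
  calc tripleNorm (planeMeasure N t) v
      ≤ ∫⁻ p : ℝ × S2, Filter.liminf (fun n : ℕ => ‖regL (1 / ((n : ℝ) + 1)) (slice v N t)
          (proj N p.2) (b p.2 + p.1 / 2)‖ₑ) Filter.atTop ∂μ := by
        refine lintegral_mono_ae ?_
        filter_upwards [hae] with p hp
        exact (tendsto_regL v p.1 hp).enorm.liminf_eq.ge
    _ ≤ Filter.liminf (fun n : ℕ => ∫⁻ p : ℝ × S2, ‖regL (1 / ((n : ℝ) + 1)) (slice v N t)
          (proj N p.2) (b p.2 + p.1 / 2)‖ₑ ∂μ) Filter.atTop :=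
        lintegral_liminf_le fun n => hm _ (slice v N t).continuous
    _ ≤ S := by
        refine Filter.liminf_le_of_frequently_le' (Filter.Frequently.of_forall fun n => ?_)
        exact hreg _ Nat.one_div_pos_of_nat

theorem exists_normB_le {ψ : E3 → ℝ} (hψ : IsLittlewoodPaley ψ) : ∃ C : ℝ≥0,
    ∀ v : 𝓢(E3, ℂ), normB v ≤ C * normBStar ψ v := by
  obtain ⟨C, hC⟩ := exists_tripleNorm_le hψ
  refine ⟨C, fun v => iSup_le fun N => ?_⟩
  refine (lintegral_mono fun t => hC v N t).trans ?_
  rw [lintegral_const_mul' _ _ ENNReal.coe_ne_top]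
  gcongr
  exact le_iSup (fun ω : S2 => ∫⁻ s : ℝ, ∑' k : ℤ,
    ENNReal.ofReal ((2 : ℝ) ^ ((k : ℝ) / 2)) * homSobolevHalf (piece ψ v ω s k)) N

/-! ### Finiteness of the Littlewood-Paley norm -/

open scoped LineDeriv in
/-- Plancherel's theorem for the derivative in the direction `m`. -/
theorem lintegral_inner_sq_fourier {F : Type*} [NormedAddCommGroup F] [InnerProductSpace ℝ F]
    [FiniteDimensional ℝ F] [MeasurableSpace F] [BorelSpace F] (f : 𝓢(F, ℂ)) {m : F}
    (hm : ‖m‖ ≤ 1) :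
    ∫⁻ ξ, ENNReal.ofReal ((2 * Real.pi * ⟪ξ, m⟫) ^ 2) * ‖𝓕 (f : F → ℂ) ξ‖ₑ ^ 2 ∂(lebesgue F) ≤
      ∫⁻ x, ‖fderiv ℝ f x‖ₑ ^ 2 ∂(lebesgue F) := by
  obtain ⟨g, hg⟩ : ∃ g : 𝓢(F, ℂ), g = ∂_{m} f := ⟨_, rfl⟩
  have h := lintegral_enorm_sq_fourier g.integrable (g.memLp 2 volume)
  have h1 : ∀ ξ, ‖𝓕 (g : F → ℂ) ξ‖ₑ ^ 2 =
      ENNReal.ofReal ((2 * Real.pi * ⟪ξ, m⟫) ^ 2) * ‖𝓕 (f : F → ℂ) ξ‖ₑ ^ 2 := by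
    intro ξ
    have : (inner ℝ · m : F → ℝ).HasTemperateGrowth := ((innerSL ℝ).flip m).hasTemperateGrowth
    rw [← SchwartzMap.fourier_coe, hg, SchwartzMap.fourier_lineDerivOp_eq, smul_apply,
      SchwartzMap.smulLeftCLM_apply_apply this, SchwartzMap.fourier_coe, enorm_smul, enorm_smul,
      mul_pow, mul_pow, ← mul_assoc, ← mul_pow]
    congr 1
    rw [← ofReal_norm, ← ofReal_norm, ← ENNReal.ofReal_mul (norm_nonneg _),
      ← ENNReal.ofReal_pow (by positivity)]
    congr 1
    simp [mul_pow, sq_abs]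
  simp_rw [h1] at h
  refine (le_of_eq h).trans (lintegral_mono fun x => ?_)
  have h2 : g x = fderiv ℝ f x m := hg ▸ SchwartzMap.lineDerivOp_apply_eq_fderiv m f x
  gcongr
  rw [h2, ← ofReal_norm, ← ofReal_norm]
  apply ENNReal.ofReal_le_ofReal
  exact ((fderiv ℝ f x).le_opNorm m).trans (mul_le_of_le_one_right (norm_nonneg _) hm)

theorem lintegral_norm_sq_fourier_le {F : Type*} [NormedAddCommGroup F] [InnerProductSpace ℝ F]
    [FiniteDimensional ℝ F] [MeasurableSpace F] [BorelSpace F] (f : 𝓢(F, ℂ)) :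
    ∫⁻ ξ, ENNReal.ofReal ((2 * Real.pi * ‖ξ‖) ^ 2) * ‖𝓕 (f : F → ℂ) ξ‖ₑ ^ 2 ∂(lebesgue F) ≤
      Module.finrank ℝ F * ∫⁻ x, ‖fderiv ℝ f x‖ₑ ^ 2 ∂(lebesgue F) := by
  have hmeas : Measurable (𝓕 (f : F → ℂ)) := (continuous_fourier f.integrable).measurable
  let e := stdOrthonormalBasis ℝ F
  have h1 : ∀ ξ : F, ENNReal.ofReal ((2 * Real.pi * ‖ξ‖) ^ 2) =
      ∑ i, ENNReal.ofReal ((2 * Real.pi * ⟪ξ, e i⟫) ^ 2) := by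
    intro ξ
    rw [← ENNReal.ofReal_sum_of_nonneg fun i _ => sq_nonneg _]
    congr 1
    simp_rw [mul_pow]
    rw [← Finset.mul_sum, e.sum_sq_inner_left]
  simp_rw [h1, Finset.sum_mul]
  rw [lintegral_finsetSum _ fun i _ => by fun_prop]
  refine (Finset.sum_le_sum fun i _ => lintegral_inner_sq_fourier f (m := e i) (by simp)).trans ?_
  simp

/-- Interpolation of `Ḣ^{1/2}` between `L²` and `Ḣ¹`: `z ≤ l + l⁻¹ z²` at `z = 2 π |ξ|`. -/
theorem lintegral_norm_mul_fourier_le {F : Type*} [NormedAddCommGroup F] [InnerProductSpace ℝ F]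
    [FiniteDimensional ℝ F] [MeasurableSpace F] [BorelSpace F] (f : 𝓢(F, ℂ)) {l : ℝ}
    (hl : 0 < l) :
    ∫⁻ ξ, ENNReal.ofReal (2 * Real.pi * ‖ξ‖) * ‖𝓕 (f : F → ℂ) ξ‖ₑ ^ 2 ∂(lebesgue F) ≤
      ENNReal.ofReal l * ∫⁻ x, ‖f x‖ₑ ^ 2 ∂(lebesgue F) + ENNReal.ofReal l⁻¹ *
        (Module.finrank ℝ F * ∫⁻ x, ‖fderiv ℝ f x‖ₑ ^ 2 ∂(lebesgue F)) := by
  have hmeas : Measurable (𝓕 (f : F → ℂ)) := (continuous_fourier f.integrable).measurable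
  have h0 : ∫⁻ ξ, ‖𝓕 (f : F → ℂ) ξ‖ₑ ^ 2 ∂(lebesgue F) = ∫⁻ x, ‖f x‖ₑ ^ 2 ∂(lebesgue F) :=
    lintegral_enorm_sq_fourier f.integrable (f.memLp 2 volume)
  have hpt : ∀ ξ : F, ENNReal.ofReal (2 * Real.pi * ‖ξ‖) * ‖𝓕 (f : F → ℂ) ξ‖ₑ ^ 2 ≤
      ENNReal.ofReal l * ‖𝓕 (f : F → ℂ) ξ‖ₑ ^ 2 + ENNReal.ofReal l⁻¹ *
        (ENNReal.ofReal ((2 * Real.pi * ‖ξ‖) ^ 2) * ‖𝓕 (f : F → ℂ) ξ‖ₑ ^ 2) := by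
    intro ξ
    rw [← mul_assoc, ← add_mul, ← ENNReal.ofReal_mul (by positivity),
      ← ENNReal.ofReal_add hl.le (by positivity)]
    gcongr
    generalize 2 * Real.pi * ‖ξ‖ = z
    have h2 : l * (l + l⁻¹ * z ^ 2) = l ^ 2 + z ^ 2 := by field_simp
    refine le_of_mul_le_mul_left ?_ hl
    rw [h2]
    nlinarith [sq_nonneg (l - z), sq_nonneg (l + z)]
  refine (lintegral_mono hpt).trans ?_
  rw [lintegral_add_left (by fun_prop), lintegral_const_mul _ (by fun_prop),
    lintegral_const_mul _ (by fun_prop), h0]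
  gcongr
  exact lintegral_norm_sq_fourier_le f

theorem lintegral_enorm_sq_le_of_bound {F G : Type*} [NormedAddCommGroup F] [InnerProductSpace ℝ F]
    [FiniteDimensional ℝ F] [MeasurableSpace F] [BorelSpace F] [NormedAddCommGroup G]
    (hF : Module.finrank ℝ F = 2) {g : F → G} {R D : ℝ} (hR0 : 0 ≤ R)
    (hR : ∀ x, R < ‖x‖ → g x = 0) (hD : ∀ x, ‖g x‖ ≤ D) :
    ∫⁻ x, ‖g x‖ₑ ^ 2 ∂(lebesgue F) ≤ ENNReal.ofReal (D ^ 2 * (Real.pi * R ^ 2)) := by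
  have h1 : ∀ x, ‖g x‖ₑ ^ 2 ≤ (Metric.closedBall (0 : F) R).indicator
      (fun _ => ENNReal.ofReal (D ^ 2)) x := by
    intro x
    by_cases hx : x ∈ Metric.closedBall (0 : F) R
    · rw [Set.indicator_of_mem hx, ← ofReal_norm, ← ENNReal.ofReal_pow (norm_nonneg _)]
      apply ENNReal.ofReal_le_ofReal
      have := hD x
      gcongr
    · rw [Set.indicator_of_notMem hx, hR x (by simpa using hx)]
      simp
  refine (lintegral_mono h1).trans ?_
  rw [lintegral_indicator Metric.isClosed_closedBall.measurableSet, setLIntegral_const,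
    lebesgue_closedBall hF hR0, ← ENNReal.ofReal_mul (by positivity)]

/-- The `k`-th term of `normBStar` decays like `2^{-|k|}`: for `k → ∞` by the decay of `v`, for
`k → -∞` because the piece lives on a disc of radius comparable to `2^k`. -/
theorem IsLittlewoodPaley.exists_homSobolevHalf_piece_le {ψ : E3 → ℝ} (hψ : IsLittlewoodPaley ψ)
    (v : 𝓢(E3, ℂ)) : ∃ C : ℝ, 0 ≤ C ∧ ∀ (ω : S2) (s : ℝ) (k : ℤ),
      ENNReal.ofReal ((2 : ℝ) ^ ((k : ℝ) / 2)) * homSobolevHalf (piece ψ v ω s k) ≤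
        ENNReal.ofReal (C * (1 / 2) ^ k.natAbs * (1 + s ^ 2)⁻¹) := by
  obtain ⟨A, B, hA, hB, h⟩ := hψ.exists_piece_bounds v
  have hpi := Real.pi_pos
  refine ⟨√(3 * Real.pi) * A * B, by positivity, fun ω s k => ?_⟩
  set κ : ℝ := 2 ^ k with hκ
  have hκ0 : 0 < κ := by positivity
  set D : ℝ := B * ((1 + κ) ^ 4)⁻¹ * (1 + s ^ 2)⁻¹ with hD
  have hD0 : 0 ≤ D := by positivity
  set f : 𝓢(perp ω, ℂ) := (hψ.hasCompactSupport_piece v ω s k).toSchwartzMap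
    (hψ.contDiff_piece v ω s k) with hf
  have hfc : (f : perp ω → ℂ) = piece ψ v ω s k := rfl
  -- the choice `l = 2^{-k}` matches the size `2^{-k}` of a derivative of the cutoff
  have h1 := lintegral_norm_mul_fourier_le f (inv_pos.2 hκ0)
  rw [hfc, finrank_perp, inv_inv] at h1
  have h2 := lintegral_enorm_sq_le_of_bound (finrank_perp ω) (g := piece ψ v ω s k)
    (R := A * κ) (by positivity) (fun x hx => ((h ω s k x).1 hx).1) (fun x => (h ω s k x).2.1)
  have h3 := lintegral_enorm_sq_le_of_bound (finrank_perp ω) (g := fderiv ℝ (piece ψ v ω s k))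
    (R := A * κ) (by positivity) (fun x hx => ((h ω s k x).1 hx).2) (fun x => (h ω s k x).2.2)
  have hκ2 : (2 : ℝ) ^ ((k : ℝ) / 2) = √κ := by
    rw [Real.sqrt_eq_rpow, hκ, ← Real.rpow_intCast, ← Real.rpow_mul (by norm_num)]
    congr 1
    ring
  have h4 : ∫⁻ ξ, ENNReal.ofReal (2 * Real.pi * ‖ξ‖) * ‖𝓕 (piece ψ v ω s k) ξ‖ₑ ^ 2
      ∂(lebesgue (perp ω)) ≤ ENNReal.ofReal (3 * Real.pi * A ^ 2 * D ^ 2 * κ * (1 + κ) ^ 2) := by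
    refine h1.trans ((add_le_add (mul_le_mul_right h2 _)
      (mul_le_mul_right (mul_le_mul_right h3 _) _)).trans ?_)
    rw [← ENNReal.ofReal_natCast, ← ENNReal.ofReal_mul (by positivity),
      ← ENNReal.ofReal_mul (by positivity), ← ENNReal.ofReal_mul (by positivity),
      ← ENNReal.ofReal_add (by positivity) (by positivity)]
    apply ENNReal.ofReal_le_ofReal
    have e1 : κ⁻¹ * (D ^ 2 * (Real.pi * (A * κ) ^ 2)) = Real.pi * A ^ 2 * D ^ 2 * κ * 1 := by
      field_simp
    have e2 : κ * (((2 : ℕ) : ℝ) * ((D * (1 + κ⁻¹)) ^ 2 * (Real.pi * (A * κ) ^ 2))) =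
        Real.pi * A ^ 2 * D ^ 2 * κ * (2 * (1 + κ) ^ 2) := by
      field_simp
      push_cast
      ring
    rw [e1, e2, ← mul_add, show 3 * Real.pi * A ^ 2 * D ^ 2 * κ * (1 + κ) ^ 2 =
      Real.pi * A ^ 2 * D ^ 2 * κ * (3 * (1 + κ) ^ 2) by ring]
    gcongr
    nlinarith
  have h5 : homSobolevHalf (piece ψ v ω s k) ≤
      ENNReal.ofReal (√(3 * Real.pi) * A * D * √κ * (1 + κ)) := by
    refine (ENNReal.rpow_le_rpow h4 (by norm_num)).trans (le_of_eq ?_)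
    rw [ofReal_rpow_half (by positivity)]
    congr 1
    rw [Real.sqrt_eq_iff_mul_self_eq (by positivity) (by positivity)]
    have e1 := Real.mul_self_sqrt hκ0.le
    have e2 := Real.mul_self_sqrt (show 0 ≤ 3 * Real.pi by positivity)
    symm
    calc _ = (√(3 * Real.pi) * √(3 * Real.pi)) * A ^ 2 * D ^ 2 * (√κ * √κ) * (1 + κ) ^ 2 := by ring
      _ = _ := by rw [e1, e2]
  rw [hκ2]
  refine (mul_le_mul_right h5 _).trans ?_
  rw [← ENNReal.ofReal_mul (by positivity)]
  apply ENNReal.ofReal_le_ofReal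
  have e1 := Real.mul_self_sqrt hκ0.le
  have h6 := two_zpow_mul_inv_le k
  rw [← hκ] at h6
  have h7 : ((1 + κ) ^ 3)⁻¹ ≤ ((1 + κ) ^ 2)⁻¹ := by
    apply inv_anti₀ (by positivity)
    nlinarith [pow_pos hκ0 2, pow_pos hκ0 3]
  calc √κ * (√(3 * Real.pi) * A * D * √κ * (1 + κ))
      = √(3 * Real.pi) * A * B * ((√κ * √κ) * ((1 + κ) ^ 3)⁻¹) * (1 + s ^ 2)⁻¹ := by
        rw [hD]; field_simp
    _ ≤ √(3 * Real.pi) * A * B * (κ * ((1 + κ) ^ 2)⁻¹) * (1 + s ^ 2)⁻¹ := by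
        rw [e1]; gcongr
    _ ≤ _ := by gcongr

theorem normBStar_lt_top {ψ : E3 → ℝ} (hψ : IsLittlewoodPaley ψ) (v : 𝓢(E3, ℂ)) :
    normBStar ψ v < ⊤ := by
  obtain ⟨C, hC, h⟩ := hψ.exists_homSobolevHalf_piece_le v
  set S : ℝ := ∑' k : ℤ, (1 / 2 : ℝ) ^ k.natAbs with hS
  have h1 : ∀ (ω : S2) (s : ℝ), ∑' k : ℤ, ENNReal.ofReal ((2 : ℝ) ^ ((k : ℝ) / 2)) *
      homSobolevHalf (piece ψ v ω s k) ≤ ENNReal.ofReal (C * S * (1 + s ^ 2)⁻¹) := by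
    intro ω s
    refine (ENNReal.tsum_le_tsum (h ω s)).trans (le_of_eq ?_)
    rw [← ENNReal.ofReal_tsum_of_nonneg (fun k => by positivity)
      ((summable_half_pow_natAbs.mul_left _).mul_right _), tsum_mul_right, tsum_mul_left]
  have h2 : ∫⁻ s : ℝ, ENNReal.ofReal (C * S * (1 + s ^ 2)⁻¹) < ⊤ :=
    (integrable_inv_one_add_sq.const_mul (C * S)).lintegral_lt_top
  exact lt_of_le_of_lt (iSup_le fun ω => lintegral_mono (h1 ω)) h2

/-! ### Scaling -/

theorem fourierMeas_rescale {l : ℝ} (hl : 0 < l) (N : S2) (t : ℝ) (v : E3 → ℂ) (ξ : E3) :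
    fourierMeas (planeMeasure N t) (rescale l v) ξ =
      fourierMeas (planeMeasure N (l⁻¹ * t)) v (l • ξ) := by
  rw [fourierMeas_planeMeasure, fourierMeas_planeMeasure]
  have h := Measure.integral_comp_smul (lebesgue (perp N)) (fun y : perp N =>
    Complex.exp (-Complex.I * (⟪(y : E3) + (l⁻¹ * t) • (N : E3), l • ξ⟫ : ℝ)) *
      v (y + (l⁻¹ * t) • (N : E3))) l⁻¹
  rw [finrank_perp, abs_of_pos (by positivity)] at h
  have h2 : ∀ I : ℂ, I = ((l ^ (-2 : ℤ) : ℝ) : ℂ) * (((l⁻¹ ^ 2)⁻¹ : ℝ) • I) := by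
    intro I
    rw [Complex.real_smul, ← mul_assoc, ← Complex.ofReal_mul]
    have : l ^ (-2 : ℤ) * (l⁻¹ ^ 2)⁻¹ = 1 := by
      rw [zpow_neg]
      field_simp
    rw [this]
    simp
  rw [h2 (∫ x' : perp N, _ ∂_), ← h2, h2 (∫ x' : perp N, Complex.exp (-Complex.I *
    (⟪(x' : E3) + (l⁻¹ * t) • (N : E3), l • ξ⟫ : ℝ)) * v (x' + (l⁻¹ * t) • (N : E3))
      ∂(lebesgue (perp N))), ← h, ← integral_const_mul]
  refine integral_congr_ae (.of_forall fun x' => ?_)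
  have e1 : l⁻¹ • ((x' : E3) + t • (N : E3)) = ((l⁻¹ • x' : perp N) : E3) + (l⁻¹ * t) • (N : E3) := by
    rw [smul_add, smul_smul, Submodule.coe_smul]
  have e2 : ⟪l⁻¹ • ((x' : E3) + t • (N : E3)), l • ξ⟫ = ⟪(x' : E3) + t • (N : E3), ξ⟫ := by
    rw [real_inner_smul_left, real_inner_smul_right, inv_mul_cancel_left₀ hl.ne']
  simp only [rescale]
  rw [← e1, e2, e1]
  ring

theorem LTransform_rescale {l : ℝ} (hl : 0 < l) (N : S2) (t : ℝ) (v : E3 → ℂ) (r : ℝ) (ω : S2) :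
    LTransform (planeMeasure N t) (rescale l v) r ω =
      ((l ^ 2)⁻¹ : ℝ) • LTransform (planeMeasure N (l⁻¹ * t)) v (l⁻¹ * r) ω := by
  unfold LTransform
  have h := integral_comp_mul_left_Ioi (fun τ : ℝ =>
    fourierMeas (planeMeasure N (l⁻¹ * t)) v (-(τ • (ω : E3))) *
      Complex.exp (Complex.I / 2 * (l⁻¹ * r : ℝ) * τ) * τ) 0 hl
  rw [mul_zero] at h
  rw [sq, mul_inv, mul_smul, ← h, ← integral_smul]
  refine setIntegral_congr_fun measurableSet_Ioi fun τ _ => ?_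
  rw [fourierMeas_rescale hl, smul_neg, smul_smul, Complex.real_smul]
  have hl' : (l : ℂ) ≠ 0 := by exact_mod_cast hl.ne'
  have e1 : Complex.I / 2 * ((l⁻¹ * r : ℝ) : ℂ) * ((l * τ : ℝ) : ℂ) = Complex.I / 2 * r * τ := by
    push_cast
    field_simp
  rw [e1]
  push_cast
  field_simp

theorem lintegral_prod_comp_mul {β : Type*} [MeasurableSpace β] (ν : Measure β) [SFinite ν]
    (f : ℝ × β → ℝ≥0∞) {c : ℝ} (hc : c ≠ 0) :
    ∫⁻ p : ℝ × β, f (c * p.1, p.2) ∂((volume : Measure ℝ).prod ν) =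
      ENNReal.ofReal |c⁻¹| * ∫⁻ p, f p ∂((volume : Measure ℝ).prod ν) := by
  let e : ℝ × β ≃ᵐ ℝ × β :=
    (Homeomorph.mulLeft₀ c hc).toMeasurableEquiv.prodCongr (MeasurableEquiv.refl β)
  have h := lintegral_map_equiv (μ := (volume : Measure ℝ).prod ν) f e
  have h2 : Measure.map e ((volume : Measure ℝ).prod ν) =
      ENNReal.ofReal |c⁻¹| • ((volume : Measure ℝ).prod ν) := by
    have h3 := Measure.map_prod_map (volume : Measure ℝ) ν
      (measurable_const_mul c) (measurable_id (α := β))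
    rw [Real.map_volume_mul_left hc, Measure.map_id, Measure.prod_smul_left] at h3
    exact h3.symm
  rw [h2, lintegral_smul_measure] at h
  exact h.symm

theorem tripleNorm_rescale {l : ℝ} (hl : 0 < l) (N : S2) (t : ℝ) (v : E3 → ℂ) :
    tripleNorm (planeMeasure N t) (rescale l v) =
      ENNReal.ofReal l⁻¹ * tripleNorm (planeMeasure N (l⁻¹ * t)) v := by
  unfold tripleNorm
  simp_rw [LTransform_rescale hl, enorm_smul]
  rw [lintegral_const_mul' _ _ enorm_ne_top,
    lintegral_prod_comp_mul _ (fun p => ‖LTransform (planeMeasure N (l⁻¹ * t)) v p.1 p.2‖ₑ)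
      (inv_ne_zero hl.ne'), ← mul_assoc, inv_inv, abs_of_pos hl,
    Real.enorm_eq_ofReal (by positivity), ← ENNReal.ofReal_mul (by positivity)]
  congr 2
  field_simp

theorem normB_rescale {l : ℝ} (hl : 0 < l) (v : E3 → ℂ) : normB (rescale l v) = normB v := by
  unfold normB
  refine iSup_congr fun N => ?_
  simp_rw [tripleNorm_rescale hl]
  rw [lintegral_const_mul' _ _ ENNReal.ofReal_ne_top,
    lintegral_comp_mul_left (fun t => tripleNorm (planeMeasure N t) v) (inv_ne_zero hl.ne'),
    ← mul_assoc, inv_inv, abs_of_pos hl, ← ENNReal.ofReal_mul (by positivity),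
    inv_mul_cancel₀ hl.ne', ENNReal.ofReal_one, one_mul]

theorem fourier_comp_inv_smul {F : Type*} [NormedAddCommGroup F] [InnerProductSpace ℝ F]
    [FiniteDimensional ℝ F] [MeasurableSpace F] [BorelSpace F] (f : F → ℂ) {l : ℝ} (hl : 0 < l)
    (ξ : F) :
    𝓕 (fun x => f (l⁻¹ • x)) ξ = ((l ^ Module.finrank ℝ F : ℝ) : ℂ) * 𝓕 f (l • ξ) := by
  rw [Real.fourier_eq', Real.fourier_eq']
  have h := Measure.integral_comp_smul volume (fun y : F =>
    Complex.exp (((-2 * Real.pi * ⟪y, l • ξ⟫ : ℝ) : ℂ) * Complex.I) • f y) l⁻¹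
  rw [abs_of_pos (by positivity), inv_pow, inv_inv, Complex.real_smul] at h
  rw [← h]
  refine integral_congr_ae (.of_forall fun x => ?_)
  simp only
  rw [real_inner_smul_left, real_inner_smul_right, inv_mul_cancel_left₀ hl.ne']

/-- On a plane, `x ↦ l⁻² f(x / l)` has the Fourier transform `ξ ↦ 𝓕 f (l ξ)`, whence the factor
`l^{-3/2}`. -/
theorem homSobolevHalf_comp_inv_smul {F : Type*} [NormedAddCommGroup F] [InnerProductSpace ℝ F]
    [FiniteDimensional ℝ F] [MeasurableSpace F] [BorelSpace F] (hF : Module.finrank ℝ F = 2)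
    (f : F → ℂ) {l : ℝ} (hl : 0 < l) :
    homSobolevHalf (fun x => ((l ^ (-2 : ℤ) : ℝ) : ℂ) * f (l⁻¹ • x)) =
      ENNReal.ofReal √((l ^ 3)⁻¹) * homSobolevHalf f := by
  have h1 : ∀ ξ, 𝓕 (fun x => ((l ^ (-2 : ℤ) : ℝ) : ℂ) * f (l⁻¹ • x)) ξ = 𝓕 f (l • ξ) := by
    intro ξ
    have h2 : 𝓕 (fun x => ((l ^ (-2 : ℤ) : ℝ) : ℂ) * f (l⁻¹ • x)) ξ =
        ((l ^ (-2 : ℤ) : ℝ) : ℂ) * 𝓕 (fun x => f (l⁻¹ • x)) ξ := by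
      rw [Real.fourier_eq', Real.fourier_eq', ← integral_const_mul]
      congr 1
      ext x
      simp only [smul_eq_mul]
      ring
    rw [h2, fourier_comp_inv_smul f hl, hF, ← mul_assoc, ← Complex.ofReal_mul]
    have : l ^ (-2 : ℤ) * l ^ 2 = 1 := by
      rw [zpow_neg]
      field_simp
    rw [this, Complex.ofReal_one, one_mul]
  rw [← homSobolevHalf_def, ← homSobolevHalf_def, ← ofReal_rpow_half (by positivity),
    ← ENNReal.mul_rpow_of_nonneg _ _ (by norm_num)]
  congr 1
  let G : F → ℝ≥0∞ := fun η => ENNReal.ofReal (2 * Real.pi * ‖η‖) * ‖𝓕 f η‖ₑ ^ 2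
  have h3 : ∀ ξ, ENNReal.ofReal (2 * Real.pi * ‖ξ‖) *
      ‖𝓕 (fun x => ((l ^ (-2 : ℤ) : ℝ) : ℂ) * f (l⁻¹ • x)) ξ‖ₑ ^ 2 =
      ENNReal.ofReal l⁻¹ * G (l • ξ) := by
    intro ξ
    have hpi := Real.pi_pos
    simp only [G]
    rw [h1, ← mul_assoc, ← ENNReal.ofReal_mul (by positivity), norm_smul,
      Real.norm_of_nonneg hl.le]
    congr 2
    field_simp
  rw [lintegral_congr h3, lintegral_const_mul' _ _ ENNReal.ofReal_ne_top,
    lintegral_comp_smul _ G hl.ne', hF, ← mul_assoc, ← ENNReal.ofReal_mul (by positivity),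
    abs_of_pos (by positivity)]
  congr 2
  field_simp

/-- Dyadic rescaling of `v` shifts the index of its Littlewood-Paley pieces. -/
theorem piece_rescale (ψ : E3 → ℝ) (v : E3 → ℂ) (m : ℤ) (ω : S2) (s : ℝ) (k : ℤ) :
    piece ψ (rescale ((2 : ℝ) ^ (-m)) v) ω s k = fun x' =>
      (((((2 : ℝ) ^ (-m)) ^ (-2 : ℤ) : ℝ)) : ℂ) *
        piece ψ v ω (((2 : ℝ) ^ (-m))⁻¹ * s) (k + m) (((2 : ℝ) ^ (-m))⁻¹ • x') := by
  ext x'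
  unfold piece rescale
  have h1 : (2 : ℝ) ^ (-(k + m)) • (((((2 : ℝ) ^ (-m))⁻¹ • x' : perp ω)) : E3) =
      (2 : ℝ) ^ (-k) • (x' : E3) := by
    rw [Submodule.coe_smul, smul_smul, ← zpow_neg, ← zpow_add₀ (by norm_num)]
    congr 2
    ring
  have h2 : ((2 : ℝ) ^ (-m))⁻¹ • ((x' : E3) + s • (ω : E3)) =
      (((((2 : ℝ) ^ (-m))⁻¹ • x' : perp ω)) : E3) + (((2 : ℝ) ^ (-m))⁻¹ * s) • (ω : E3) := by
    rw [smul_add, smul_smul, Submodule.coe_smul]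
  rw [h1, h2]
  ring

theorem normBStar_rescale (ψ : E3 → ℝ) (v : E3 → ℂ) (m : ℤ) :
    normBStar ψ (rescale ((2 : ℝ) ^ (-m)) v) = normBStar ψ v := by
  unfold normBStar
  refine iSup_congr fun ω => ?_
  set l : ℝ := (2 : ℝ) ^ (-m) with hl
  have hl0 : 0 < l := by positivity
  have h1 : ∀ s : ℝ, ∑' k : ℤ, ENNReal.ofReal ((2 : ℝ) ^ ((k : ℝ) / 2)) *
      homSobolevHalf (piece ψ (rescale l v) ω s k) =
      ENNReal.ofReal l⁻¹ * ∑' k : ℤ, ENNReal.ofReal ((2 : ℝ) ^ ((k : ℝ) / 2)) *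
        homSobolevHalf (piece ψ v ω (l⁻¹ * s) k) := by
    intro s
    rw [← (Equiv.addRight m).tsum_eq (fun k : ℤ => ENNReal.ofReal ((2 : ℝ) ^ ((k : ℝ) / 2)) *
        homSobolevHalf (piece ψ v ω (l⁻¹ * s) k)), ← ENNReal.tsum_mul_left]
    refine tsum_congr fun k => ?_
    rw [hl, piece_rescale, ← hl, homSobolevHalf_comp_inv_smul (finrank_perp ω) _ hl0, ← mul_assoc,
      ← mul_assoc, ← ENNReal.ofReal_mul (by positivity), ← ENNReal.ofReal_mul (by positivity)]
    congr 2
    have e1 : l = (2 : ℝ) ^ (-(m : ℝ)) := by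
      rw [hl, ← Real.rpow_intCast]
      push_cast
      rfl
    have e2 : (l ^ 3)⁻¹ = (2 : ℝ) ^ (3 * (m : ℝ)) := by
      rw [e1, ← Real.rpow_natCast, ← Real.rpow_mul (by norm_num), ← Real.rpow_neg (by norm_num)]
      congr 1
      push_cast
      ring
    have e3 : l⁻¹ = (2 : ℝ) ^ (m : ℝ) := by
      rw [e1, ← Real.rpow_neg (by norm_num), neg_neg]
    rw [e2, e3, Real.sqrt_eq_rpow, ← Real.rpow_mul (by norm_num), ← Real.rpow_add (by norm_num),
      ← Real.rpow_add (by norm_num)]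
    congr 1
    simp only [Equiv.coe_addRight]
    push_cast
    ring
  simp_rw [h1]
  rw [lintegral_const_mul' _ _ ENNReal.ofReal_ne_top,
    lintegral_comp_mul_left (fun s => ∑' k : ℤ, ENNReal.ofReal ((2 : ℝ) ^ ((k : ℝ) / 2)) *
        homSobolevHalf (piece ψ v ω s k)) (inv_ne_zero hl0.ne'),
    ← mul_assoc, inv_inv, abs_of_pos hl0, ← ENNReal.ofReal_mul (by positivity),
    inv_mul_cancel₀ hl0.ne', ENNReal.ofReal_one, one_mul]

/-! ### Existence of a Littlewood-Paley function -/

/-- Telescoping sum of a sequence that is eventually constant. -/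
theorem hasSum_sub_of_eventually_const {G : ℕ → ℝ} {c : ℝ} {m : ℕ} (h : ∀ n, m ≤ n → G n = c) :
    HasSum (fun n => G (n + 1) - G n) (c - G 0) := by
  have h1 : ∀ n ∉ Finset.range m, G (n + 1) - G n = 0 := by
    intro n hn
    rw [Finset.mem_range, not_lt] at hn
    rw [h n hn, h (n + 1) (by omega), sub_self]
  have h2 : HasSum (fun n => G (n + 1) - G n) (∑ n ∈ Finset.range m, (G (n + 1) - G n)) :=
    hasSum_sum_of_ne_finset_zero h1
  rwa [Finset.sum_range_sub, h m le_rfl] at h2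

/-- A Littlewood-Paley function `φ(x) - φ(2 x)`, for a bump function `φ` equal to `1` on the unit
ball and supported in the ball of radius `2`; the dyadic sum telescopes. -/
theorem exists_isLittlewoodPaley : ∃ ψ : E3 → ℝ, IsLittlewoodPaley ψ := by
  let φ : ContDiffBump (0 : E3) := ⟨1, 2, one_pos, one_lt_two⟩
  have hφ1 : ∀ x : E3, ‖x‖ ≤ 1 → φ x = 1 := fun x hx =>
    φ.one_of_mem_closedBall (by simpa [φ] using hx)
  have hφ0 : ∀ x : E3, 2 ≤ ‖x‖ → φ x = 0 := fun x hx =>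
    φ.zero_of_le_dist (by simpa [φ] using hx)
  refine ⟨fun x => φ x - φ ((2 : ℝ) • x), ?_, ?_, ?_, ?_⟩
  · exact φ.contDiff.sub (φ.contDiff.comp (contDiff_const_smul (2 : ℝ)))
  · refine HasCompactSupport.of_support_subset_isCompact (isCompact_closedBall (0 : E3) 2)
      fun x hx => ?_
    rw [mem_closedBall_zero_iff]
    by_contra! h
    apply hx
    simp only
    rw [hφ0 x h.le, hφ0 _ (by rw [norm_smul]; norm_num; linarith), sub_self]
  · rw [notMem_tsupport_iff_eventuallyEq]
    filter_upwards [Metric.ball_mem_nhds (0 : E3) (ε := 1 / 2) (by norm_num)] with x hx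
    rw [mem_ball_zero_iff] at hx
    simp only [Pi.zero_apply]
    rw [hφ1 x (by linarith), hφ1 _ (by rw [norm_smul]; norm_num; linarith), sub_self]
  · intro x hx
    have hx0 : 0 < ‖x‖ := norm_pos_iff.2 hx
    obtain ⟨m₁, hm₁⟩ := pow_unbounded_of_one_lt ‖x‖ (one_lt_two (α := ℝ))
    obtain ⟨m₂, hm₂⟩ := pow_unbounded_of_one_lt (2 / ‖x‖) (one_lt_two (α := ℝ))
    rw [div_lt_iff₀ hx0] at hm₂
    set g : ℤ → ℝ := fun k => φ ((2 : ℝ) ^ (-k) • x) with hg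
    have hfg : ∀ k : ℤ, φ ((2 : ℝ) ^ (-k) • x) - φ ((2 : ℝ) • (2 : ℝ) ^ (-k) • x) =
        g k - g (k - 1) := by
      intro k
      simp only [hg]
      rw [smul_smul, ← zpow_one_add₀ (by norm_num)]
      congr 4
      ring
    simp only [hfg]
    -- `g k = 1` for large `k` and `g k = 0` for very negative `k`; the two halves of the sum
    -- telescope separately
    have hp : HasSum (fun n : ℕ => g n - g (n - 1)) (1 - g (-1)) := by
      have h := hasSum_sub_of_eventually_const (G := fun n : ℕ => g (n - 1)) (c := 1)
        (m := m₁ + 1) ?_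
      · simpa using h
      · intro n hn
        apply hφ1
        rw [norm_smul, Real.norm_of_nonneg (by positivity), zpow_neg,
          inv_mul_le_iff₀ (by positivity), mul_one]
        refine hm₁.le.trans ?_
        rw [← zpow_natCast]
        exact zpow_le_zpow_right₀ one_le_two (by omega)
    have hn : HasSum (fun n : ℕ => g (-(n + 1 : ℤ)) - g (-(n + 1 : ℤ) - 1)) (g (-1)) := by
      have h := (hasSum_sub_of_eventually_const (G := fun n : ℕ => g (-(n + 1 : ℤ))) (c := 0)
        (m := m₂) ?_).neg
      · simp only [Nat.cast_zero, zero_add, zero_sub, neg_neg] at h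
        have e : (fun n : ℕ => g (-(n + 1 : ℤ)) - g (-(n + 1 : ℤ) - 1)) =
            fun n : ℕ => -(g (-(((n + 1 : ℕ) : ℤ) + 1)) - g (-(n + 1 : ℤ))) := by
          funext n
          rw [neg_sub]
          congr 2
        rwa [e]
      · intro n hn
        apply hφ0
        rw [norm_smul, Real.norm_of_nonneg (by positivity), neg_neg]
        refine hm₂.le.trans ?_
        gcongr
        rw [← zpow_natCast]
        exact zpow_le_zpow_right₀ one_le_two (by omega)
    have := HasSum.of_nat_of_neg_add_one (f := fun k : ℤ => g k - g (k - 1)) hp hn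
    simpa using this

end StructureNorm

theorem mainTheorem3 :
    (∀ (v : 𝓢(StructureNorm.E3, ℂ)) (l : ℝ), 0 < l →
      StructureNorm.normB (StructureNorm.rescale l v) = StructureNorm.normB v) ∧
    (∀ v : 𝓢(StructureNorm.E3, ℂ), StructureNorm.normB v < ⊤) ∧
    (∀ ψ : StructureNorm.E3 → ℝ, StructureNorm.IsLittlewoodPaley ψ →
      (∃ C : ℝ≥0, ∀ v : 𝓢(StructureNorm.E3, ℂ),
        StructureNorm.normB v ≤ C * StructureNorm.normBStar ψ v) ∧
      (∀ v : 𝓢(StructureNorm.E3, ℂ), StructureNorm.normBStar ψ v < ⊤) ∧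
      (∀ (v : 𝓢(StructureNorm.E3, ℂ)) (ℓ : ℤ),
        StructureNorm.normBStar ψ (StructureNorm.rescale ((2 : ℝ) ^ (-ℓ)) v) =
          StructureNorm.normBStar ψ v)) := by
  refine ⟨fun v l hl => StructureNorm.normB_rescale hl v, fun v => ?_, fun ψ hψ =>
    ⟨StructureNorm.exists_normB_le hψ, StructureNorm.normBStar_lt_top hψ,
      fun v ℓ => StructureNorm.normBStar_rescale ψ v ℓ⟩⟩
  obtain ⟨ψ, hψ⟩ := StructureNorm.exists_isLittlewoodPaley
  obtain ⟨C, hC⟩ := StructureNorm.exists_normB_le hψ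
  exact (hC v).trans_lt (ENNReal.mul_lt_top ENNReal.coe_lt_top
    (StructureNorm.normBStar_lt_top hψ v))
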